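/- Let $\mathbf G$ be a finite poset in which any two elements have a greatest lower bound, regarded as a category with one morphism $i\to j$ whenever $i\le j$ (an indexing category, or complete poset category), and let $|\mathbf G|$ be its number of objects. A finite probability space is a set with a probability distribution of finite support; a reduction is a measure-preserving map, two maps being identified if they agree on all atoms (points of positive weight). A $\mathbf G$-diagram is a functor from $\mathbf G$ to finite probability spaces and reductions, and reductions of diagrams are natural transformations. Let $\otimes$ be the (objectwise) independent product, $\mathcal X^n$ the $n$-fold tensor power, and $H$ the Shannon entropy. The intrinsic entropy distance is \[ \mathbf{k}(\mathcal X,\mathcal Y)=\inf_{\mathcal X\leftarrow\mathcal Z\to\mathcal Y}\ \sum_{i\in\mathbf G}\bigl(|H(Z_i)-H(X_i)|+|H(Z_i)-H(Y_i)|\bigr), \] the infimum being over all pairs of reductions of $\mathbf G$-diagrams with common domain. For sequences of diagrams put $\boldsymbol\kappa(\bar{\mathcal A},\bar{\mathcal B})=\lim_{n\to\infty}\frac1n\mathbf k(\mathcal A(n),\mathcal B(n))$, whenever the limit exists, and for diagrams $\boldsymbol\kappa(\mathcal A,\mathcal B)=\lim_{n\to\infty}\frac1n\mathbf k(\mathcal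 A^n,\mathcal B^n)$. Fix a non-decreasing function $\varphi:[1,\infty)\to(0,\infty)$ that is admissible: for some constant $D$, $8t\int_t^\infty\varphi(s)s^{-2}\,ds\le D\varphi(t)$ for all $t\ge1$. A sequence $(\mathcal A(n))_{n\ge0}$ of $\mathbf G$-diagrams is quasi-linear if for some constant $C$, $\boldsymbol\kappa(\mathcal A(n+m),\mathcal A(n)\otimes\mathcal A(m))\le C\varphi(n+m)$ for all $n,m\ge 0$ with $n+m\ge1$. A tropical $\mathbf G$-diagram is a class of quasi-linear sequences, two sequences being equivalent if $\boldsymbol\kappa$ between them is $0$; the asymptotic entropy distance $\boldsymbol\kappa$ of two classes is that of their representatives. For a $\mathbf G$-diagram $\mathcal X$, an object $\iota$, $U=X_\iota$ with distribution $p$, and an atom $u\in U$, let $\mathcal X|u$ be the diagram on the same sets and maps in which the space at $i$ carries the push-forward, under the map from the initial space $X_0$ to $X_i$, of the distribution of $X_0$ conditioned on the fiber over $u$. The tropical conditioned diagram $[\mathcal X|U]$ is the class of the sequence $n\mapsto\bigotimes_{u}(\mathcal X|u)^{\lfloor n\,p(u)\rfloor}$, the product being over the atoms $u$ of $U$. Proposition.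 Let $\mathcal X,\mathcal Y$ be $\mathbf G$-diagrams of finite probability spaces, $\iota\in\mathbf G$, $U=X_\iota$ and $V=Y_\iota$. Then $[\mathcal X|U]$ and $[\mathcal Y|V]$ are tropical $\mathbf G$-diagrams, the asymptotic entropy distance between them exists (the limit exists and is the same for all representatives), and \[ \boldsymbol\kappa\bigl([\mathcal X|U],[\mathcal Y|V]\bigr)\le(2|\mathbf G|+1)\,\mathbf k(\mathcal X,\mathcal Y). \] -/

import Mathlib

open CategoryTheory

universe u v

/-- A finite probability space: a set with a probability distribution of finite support. -/
structure FinProb : Type (u + 1) where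
  carrier : Type u
  p : PMF carrier
  finite_support : p.support.Finite

namespace FinProb

/-- Measure-preserving maps between finite probability spaces. -/
structure MeasurePreservingMap (X Y : FinProb.{u}) : Type u where
  toFun : X.carrier → Y.carrier
  map_eq : X.p.map toFun = Y.p

/-- Two measure-preserving maps are equivalent if they coincide on a set of full measure,
that is, on all atoms. -/
instance reductionSetoid (X Y : FinProb.{u}) : Setoid (MeasurePreservingMap X Y) where
  r f g := ∀ x ∈ X.p.support, f.toFun x = g.toFun x
  iseqv :=
    ⟨fun _ _ _ => rfl, fun h x hx => (h x hx).symm,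
      fun h h' x hx => (h x hx).trans (h' x hx)⟩

/-- A reduction is an equivalence class of measure-preserving maps. -/
def Reduction (X Y : FinProb.{u}) : Type u := Quotient (reductionSetoid X Y)

theorem map_congr_support {A B : Type u} (p : PMF A) {f g : A → B}
    (h : ∀ x ∈ p.support, f x = g x) : p.map f = p.map g := by
  ext b
  rw [PMF.map_apply, PMF.map_apply]
  refine tsum_congr fun a => ?_
  by_cases ha : a ∈ p.support
  · rw [h a ha]
  · rw [PMF.mem_support_iff, not_not] at ha
    simp [ha]

theorem mem_support_of_map {X Y : FinProb.{u}} (f : MeasurePreservingMap X Y)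
    {x : X.carrier} (hx : x ∈ X.p.support) : f.toFun x ∈ Y.p.support := by
  have h : f.toFun x ∈ (X.p.map f.toFun).support := by
    rw [PMF.support_map]
    exact ⟨x, hx, rfl⟩
  rwa [f.map_eq] at h

namespace Reduction

def id (X : FinProb.{u}) : Reduction X X :=
  Quotient.mk _ ⟨fun x => x, PMF.map_id X.p⟩

def comp {X Y Z : FinProb.{u}} (r : Reduction X Y) (s : Reduction Y Z) : Reduction X Z :=
  Quotient.map₂
    (fun (f : MeasurePreservingMap X Y) (g : MeasurePreservingMap Y Z) =>
      (⟨fun x => g.1 (f.1 x), by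
        have := PMF.map_comp f.1 X.p g.1
        rw [f.2, g.2] at this
        exact this.symm⟩ : MeasurePreservingMap X Z))
    (fun f f' hf g g' hg x hx => by
      change g.1 (f.1 x) = g'.1 (f'.1 x)
      rw [← hf x hx]
      exact hg _ (mem_support_of_map f hx)) r s

end Reduction

/-- The category of finite probability spaces and reductions. -/
instance category : Category.{u} FinProb.{u} where
  Hom := Reduction
  id := Reduction.id
  comp := Reduction.comp
  id_comp r := by
    induction r using Quotient.inductionOn
    rfl
  comp_id r := by
    induction r using Quotient.inductionOn
    rfl
  assoc r s t := by
    induction r using Quotient.inductionOn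
    induction s using Quotient.inductionOn
    induction t using Quotient.inductionOn
    rfl

/-- The class of a measure-preserving map. -/
def homOf {X Y : FinProb.{u}} (f : X.carrier → Y.carrier) (hf : X.p.map f = Y.p) : X ⟶ Y :=
  Quotient.mk (reductionSetoid X Y) ⟨f, hf⟩

/-- A chosen representative of a reduction; it is determined up to a set of measure zero. -/
noncomputable def rep {X Y : FinProb.{u}} (r : X ⟶ Y) : X.carrier → Y.carrier :=
  (Quotient.out (s := reductionSetoid X Y) r).1

theorem map_rep {X Y : FinProb.{u}} (r : X ⟶ Y) : X.p.map (rep r) = Y.p :=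
  (Quotient.out (s := reductionSetoid X Y) r).2

theorem homOf_rep {X Y : FinProb.{u}} (r : X ⟶ Y) : homOf (rep r) (map_rep r) = r :=
  Quotient.out_eq (s := reductionSetoid X Y) r

theorem homOf_eq_iff {X Y : FinProb.{u}} {f g : X.carrier → Y.carrier}
    {hf : X.p.map f = Y.p} {hg : X.p.map g = Y.p} :
    homOf f hf = homOf g hg ↔ ∀ x ∈ X.p.support, f x = g x :=
  Quotient.eq (r := reductionSetoid X Y)

theorem rep_homOf {X Y : FinProb.{u}} (f : X.carrier → Y.carrier) (hf : X.p.map f = Y.p)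
    {x : X.carrier} (hx : x ∈ X.p.support) : rep (homOf f hf) x = f x :=
  homOf_eq_iff.1 (homOf_rep (homOf f hf)) x hx

theorem rep_mem_support {X Y : FinProb.{u}} (r : X ⟶ Y) {x : X.carrier}
    (hx : x ∈ X.p.support) : rep r x ∈ Y.p.support :=
  mem_support_of_map ⟨rep r, map_rep r⟩ hx

theorem rep_id {X : FinProb.{u}} {x : X.carrier} (hx : x ∈ X.p.support) :
    rep (𝟙 X) x = x :=
  rep_homOf (fun x => x) (PMF.map_id X.p) hx

theorem rep_comp {X Y Z : FinProb.{u}} (r : X ⟶ Y) (s : Y ⟶ Z) {x : X.carrier}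
    (hx : x ∈ X.p.support) : rep (r ≫ s) x = rep s (rep r x) := by
  have hp : X.p.map (fun x => rep s (rep r x)) = Z.p := by
    have := PMF.map_comp (rep r) X.p (rep s)
    rw [map_rep, map_rep] at this
    exact this.symm
  have h : r ≫ s = homOf (fun x => rep s (rep r x)) hp := by
    conv_lhs => rw [← homOf_rep r, ← homOf_rep s]
    rfl
  rw [h]
  exact rep_homOf _ _ hx

/-- The atoms of a finite probability space: the points of positive weight. -/
def Atom (X : FinProb.{u}) : Type u := {x : X.carrier // x ∈ X.p.support}

noncomputable instance fintypeAtom (X : FinProb.{u}) : Fintype X.Atom :=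
  X.finite_support.fintype

/-- The weight of an atom, as a real number. -/
noncomputable def weight (X : FinProb.{u}) (x : X.Atom) : ℝ := (X.p x.1).toReal

/-- Shannon entropy. -/
noncomputable def entropy (X : FinProb.{u}) : ℝ := ∑ x : X.Atom, Real.negMulLog (X.weight x)

/-- The independent product of two finite probability spaces. -/
noncomputable def tensor (X Y : FinProb.{u}) : FinProb.{u} where
  carrier := X.carrier × Y.carrier
  p := X.p.bind fun x => Y.p.map fun y => (x, y)
  finite_support := by
    refine (X.finite_support.prod Y.finite_support).subset ?_
    rintro ⟨a, b⟩ h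
    simp only [PMF.mem_support_bind_iff, PMF.support_map, Set.mem_image, Prod.mk.injEq] at h
    obtain ⟨x, hx, y, hy, rfl, rfl⟩ := h
    exact ⟨hx, hy⟩

theorem mem_support_tensor {X Y : FinProb.{u}} {z : X.carrier × Y.carrier}
    (h : z ∈ (tensor X Y).p.support) : z.1 ∈ X.p.support ∧ z.2 ∈ Y.p.support := by
  obtain ⟨a, b⟩ := z
  replace h : (a, b) ∈ (X.p.bind fun x => Y.p.map fun y => (x, y)).support := h
  simp only [PMF.mem_support_bind_iff, PMF.support_map, Set.mem_image, Prod.mk.injEq] at h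
  obtain ⟨x, hx, y, hy, rfl, rfl⟩ := h
  exact ⟨hx, hy⟩

theorem map_tensor {X X' Y Y' : FinProb.{u}} (f : X.carrier → X'.carrier)
    (g : Y.carrier → Y'.carrier) (hf : X.p.map f = X'.p) (hg : Y.p.map g = Y'.p) :
    (tensor X Y).p.map (Prod.map f g) = (tensor X' Y').p := by
  simp only [tensor]
  rw [PMF.map_bind, ← hf, ← hg, PMF.bind_map]
  simp only [PMF.map_comp]
  rfl

/-- The product of two reductions. -/
noncomputable def tensorHom {X X' Y Y' : FinProb.{u}} (r : X ⟶ X') (s : Y ⟶ Y') :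
    tensor X Y ⟶ tensor X' Y' :=
  homOf (Prod.map (rep r) (rep s)) (map_tensor _ _ (map_rep r) (map_rep s))

/-- The one-point probability space. -/
noncomputable def one : FinProb.{u} where
  carrier := PUnit
  p := PMF.pure PUnit.unit
  finite_support := Set.toFinite _

end FinProb

/-- A `G`-diagram of finite probability spaces: a functor from the poset `G`, seen as a category
with one morphism `i ⟶ j` whenever `i ≤ j`, to finite probability spaces.  A reduction of
`G`-diagrams is a natural transformation. -/
abbrev ProbDiagram (G : Type v) [Preorder G] : Type (max v (u + 1)) := G ⥤ FinProb.{u}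

namespace ProbDiagram

section Basic

variable {G : Type v} [Preorder G]

/-- The tensor product of two diagrams. -/
noncomputable def tensor (X Y : ProbDiagram.{u} G) : ProbDiagram.{u} G where
  obj i := FinProb.tensor (X.obj i) (Y.obj i)
  map h := FinProb.tensorHom (X.map h) (Y.map h)
  map_id i := by
    refine FinProb.homOf_eq_iff.2 fun z hz => ?_
    have hz' := FinProb.mem_support_tensor hz
    simp only [X.map_id, Y.map_id]
    exact Prod.ext (FinProb.rep_id hz'.1) (FinProb.rep_id hz'.2)
  map_comp {i j k} h h' := by
    refine FinProb.homOf_eq_iff.2 fun z hz => ?_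
    have hz' := FinProb.mem_support_tensor hz
    simp only [X.map_comp, Y.map_comp]
    exact Prod.ext (FinProb.rep_comp _ _ hz'.1) (FinProb.rep_comp _ _ hz'.2)

/-- The constant one-point diagram, the unit of the tensor product. -/
noncomputable def one (G : Type v) [Preorder G] : ProbDiagram.{u} G :=
  (Functor.const G).obj FinProb.one

/-- The tensor power `X ^ n`. -/
noncomputable def pow (X : ProbDiagram.{u} G) : ℕ → ProbDiagram.{u} G
  | 0 => one G
  | n + 1 => tensor (pow X n) X

variable [Fintype G]

/-- The entropy distance of a fan `X ⟵ Z ⟶ Y`: the sum of the `ℓ¹`-distances between the entropy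
vectors of `Z` and `X` and of `Z` and `Y`. -/
noncomputable def entropyDist {X Y Z : ProbDiagram.{u} G} (_f : Z ⟶ X) (_g : Z ⟶ Y) : ℝ :=
  (∑ i, |(Z.obj i).entropy - (X.obj i).entropy|) +
    ∑ i, |(Z.obj i).entropy - (Y.obj i).entropy|

/-- The intrinsic entropy distance: the infimum of the entropy distances of all fans
`X ⟵ Z ⟶ Y`. -/
noncomputable def intrinsicDist (X Y : ProbDiagram.{u} G) : ℝ :=
  sInf {d : ℝ | ∃ (Z : ProbDiagram.{u} G) (f : Z ⟶ X) (g : Z ⟶ Y), d = entropyDist f g}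

end Basic

section Conditioning

variable {G : Type v} [SemilatticeInf G] [Fintype G]

/-- The initial object of a finite poset with binary meets, non-empty since it contains `ι`. -/
def initialObj (ι : G) : G := Finset.univ.inf' ⟨ι, Finset.mem_univ ι⟩ (fun i => i)

theorem initialObj_le (ι i : G) : initialObj ι ≤ i :=
  Finset.inf'_le (fun i => i) (Finset.mem_univ i)

/-- The map from the initial space of a diagram to the space at `i`. -/
noncomputable def fromInitial (X : ProbDiagram.{u} G) (ι i : G) :
    (X.obj (initialObj ι)).carrier → (X.obj i).carrier :=
  FinProb.rep (X.map (homOfLE (initialObj_le ι i)))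

theorem exists_fiber (X : ProbDiagram.{u} G) (ι : G) (x : (X.obj ι).Atom) :
    ∃ s ∈ {s | fromInitial X ι ι s = x.1}, s ∈ (X.obj (initialObj ι)).p.support := by
  have h : x.1 ∈ ((X.obj (initialObj ι)).p.map (fromInitial X ι ι)).support := by
    rw [fromInitial, FinProb.map_rep]
    exact x.2
  rw [PMF.support_map] at h
  obtain ⟨s, hs, hs'⟩ := h
  exact ⟨s, hs', hs⟩

/-- The distribution of the initial space conditioned on the atom `x` of the space at `ι`: it is
the normalized restriction to the fiber over `x`. -/
noncomputable def condInitial (X : ProbDiagram.{u} G) (ι : G) (x : (X.obj ι).Atom) :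
    PMF (X.obj (initialObj ι)).carrier :=
  (X.obj (initialObj ι)).p.filter {s | fromInitial X ι ι s = x.1} (exists_fiber X ι x)

theorem mem_support_of_cond {X : ProbDiagram.{u} G} {ι : G} {x : (X.obj ι).Atom}
    {s : (X.obj (initialObj ι)).carrier} (hs : s ∈ (condInitial X ι x).support) :
    s ∈ (X.obj (initialObj ι)).p.support := by
  rw [condInitial, PMF.support_filter] at hs
  exact hs.2

/-- The space at `i` of the conditioned diagram: the same set, with the push-forward of the
conditioned distribution of the initial space. -/
noncomputable def condSpace (X : ProbDiagram.{u} G) (ι : G) (x : (X.obj ι).Atom) (i : G) :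
    FinProb.{u} where
  carrier := (X.obj i).carrier
  p := (condInitial X ι x).map (fromInitial X ι i)
  finite_support := by
    rw [PMF.support_map]
    exact ((X.obj (initialObj ι)).finite_support.subset
      fun s hs => mem_support_of_cond hs).image _

theorem mem_support_of_condSpace {X : ProbDiagram.{u} G} {ι : G} {x : (X.obj ι).Atom} {i : G}
    {a : (X.obj i).carrier} (ha : a ∈ (condSpace X ι x i).p.support) :
    a ∈ (X.obj i).p.support := by
  simp only [condSpace] at ha
  rw [PMF.support_map] at ha
  obtain ⟨s, hs, rfl⟩ := ha
  exact FinProb.rep_mem_support _ (mem_support_of_cond hs)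

theorem map_condSpace (X : ProbDiagram.{u} G) (ι : G) (x : (X.obj ι).Atom) {i j : G}
    (h : i ⟶ j) : (condSpace X ι x i).p.map (FinProb.rep (X.map h)) = (condSpace X ι x j).p := by
  simp only [condSpace]
  rw [PMF.map_comp]
  refine FinProb.map_congr_support _ fun s hs => ?_
  have := FinProb.rep_comp (X.map (homOfLE (initialObj_le ι i))) (X.map h)
    (mem_support_of_cond hs)
  rw [← X.map_comp] at this
  exact this.symm

/-- The conditioned diagram `X | x`, for an atom `x` of the space of `X` at `ι`. -/
noncomputable def cond (X : ProbDiagram.{u} G) (ι : G) (x : (X.obj ι).Atom) :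
    ProbDiagram.{u} G where
  obj i := condSpace X ι x i
  map {i j} h := FinProb.homOf (X := condSpace X ι x i) (Y := condSpace X ι x j)
    (FinProb.rep (X := X.obj i) (Y := X.obj j) (X.map h)) (map_condSpace X ι x h)
  map_id i := by
    refine FinProb.homOf_eq_iff.2 fun a ha => ?_
    rw [X.map_id]
    exact FinProb.rep_id (mem_support_of_condSpace ha)
  map_comp {i j k} h h' := by
    refine FinProb.homOf_eq_iff.2 fun a ha => ?_
    rw [X.map_comp]
    exact FinProb.rep_comp _ _ (mem_support_of_condSpace ha)

end Conditioning

end ProbDiagram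

/-! Tropical diagrams -/

namespace Tropical

section Sequences

variable {G : Type v} [Preorder G]

/-- The linear sequence generated by a diagram. -/
noncomputable def linearSeq (X : ProbDiagram.{u} G) : ℕ → ProbDiagram.{u} G :=
  fun n => X.pow n

/-- The sum of two sequences: the term-wise tensor product. -/
noncomputable def addSeq (A B : ℕ → ProbDiagram.{u} G) : ℕ → ProbDiagram.{u} G :=
  fun n => (A n).tensor (B n)

/-- The zero sequence. -/
noncomputable def zeroSeq (G : Type v) [Preorder G] : ℕ → ProbDiagram.{u} G :=
  fun _ => ProbDiagram.one G

/-- The action of a non-negative real number `t` on sequences. -/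
noncomputable def smulSeq (t : ℝ) (A : ℕ → ProbDiagram.{u} G) : ℕ → ProbDiagram.{u} G :=
  fun n => A ⌊(n : ℝ) * t⌋₊

variable [Fintype G]

/-- The asymptotic entropy distance of two sequences exists and equals `d`. -/
def IsAsympDist (A B : ℕ → ProbDiagram.{u} G) (d : ℝ) : Prop :=
  Filter.Tendsto (fun n : ℕ => 1 / (n : ℝ) * ProbDiagram.intrinsicDist (A n) (B n))
    Filter.atTop (nhds d)

/-- Admissible functions `[1, ∞) → [0, ∞)`; values outside `[1, ∞)` are irrelevant. -/
def IsAdmissible (φ : ℝ → ℝ) : Prop :=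
  MonotoneOn φ (Set.Ici 1) ∧ (∀ t, 1 ≤ t → 0 ≤ φ t) ∧
    ∃ D : ℝ, ∀ t, 1 ≤ t →
      MeasureTheory.IntegrableOn (fun s => φ s / s ^ 2) (Set.Ioi t) ∧
        8 * t * ∫ s in Set.Ioi t, φ s / s ^ 2 ≤ D * φ t

/-- A sequence is quasi-linear with defect bounded by `φ` (up to a constant factor) in the
asymptotic entropy distance, which for diagrams is that of the linear sequences they generate. -/
def IsQuasiLinear (φ : ℝ → ℝ) (A : ℕ → ProbDiagram.{u} G) : Prop :=
  ∃ C : ℝ, ∀ n m : ℕ, 1 ≤ n + m → ∃ d : ℝ,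
    IsAsympDist (linearSeq (A (n + m))) (linearSeq ((A n).tensor (A m))) d ∧
      d ≤ C * φ ((n + m : ℕ) : ℝ)

/-- The class of a sequence: all quasi-linear sequences at asymptotic distance zero from it. The
tropical diagrams are the classes of the quasi-linear sequences. -/
def tropicalClass (φ : ℝ → ℝ) (A : ℕ → ProbDiagram.{u} G) : Set (ℕ → ProbDiagram.{u} G) :=
  {B | IsQuasiLinear φ B ∧ IsAsympDist A B 0}

/-- A tropical diagram: the class of some quasi-linear sequence. -/
def IsTropicalDiagram (φ : ℝ → ℝ) (S : Set (ℕ → ProbDiagram.{u} G)) : Prop :=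
  ∃ A, IsQuasiLinear φ A ∧ S = tropicalClass φ A

/-- The asymptotic entropy distance of two classes exists, is independent of the
representatives, and equals `d`. -/
def IsTropicalDist (S T : Set (ℕ → ProbDiagram.{u} G)) (d : ℝ) : Prop :=
  ∀ A ∈ S, ∀ B ∈ T, IsAsympDist A B d

end Sequences

section Conditioning

variable {G : Type v} [SemilatticeInf G] [Fintype G]

/-- The sequence `∑ x, p(x) • linearSeq (X | x)`, the sum being over the atoms `x` of the space of
`X` at `ι`; its `n`-th term is the tensor product of the `(X | x) ^ ⌊n * p(x)⌋`. -/
noncomputable def condSeq (X : ProbDiagram.{u} G) (ι : G) : ℕ → ProbDiagram.{u} G :=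
  ((Finset.univ : Finset (X.obj ι).Atom).toList.map fun x =>
    smulSeq ((X.obj ι).weight x) (linearSeq (X.cond ι x))).foldr addSeq (zeroSeq G)

/-- The tropical conditioned diagram `[X | U]`, where `U` is the space of `X` at `ι`. -/
def tropicalCond (φ : ℝ → ℝ) (X : ProbDiagram.{u} G) (ι : G) :
    Set (ℕ → ProbDiagram.{u} G) :=
  tropicalClass φ (condSeq X ι)

end Conditioning

end Tropical

/-! Up to points of weight zero, a diagram over a poset with an initial object is a single
probability space, its initial one, with a partition for every object. A fan induces a coupling of
the initial spaces of no larger cost, and every coupling comes from a fan of equal cost. So the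
intrinsic distance is `edist`, the infimum over couplings of the sum over `i` of `2 H(joint) - H(A)
- H(B)`. Submodularity of entropy gives the triangle inequality, products of couplings make the
tensor product 1-Lipschitz, and the quotient by distance zero is a metric commutative monoid,
`EntropyClass`.

Fix a coupling and pull `U` and `V` back to it. Conditioning on the pair `(U, V)` cuts it into
couplings of the conditioned spaces whose average cost is at most the original cost, so conditioning
both sides on the same pair gives sequences at asymptotic distance at most the cost
(`dist_condSum_left_right_le`). It remains to compare conditioning on `U` with conditioning on `(U,
V)`, and likewise for `V`.

This rests on a mixture inequality (`edist_le_mix`): a space may be replaced by a random one of its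
conditioned spaces at the price of `2|G|` times the entropy of the conditioning variable. Applied to
one copy after another of a power, it leaves a sum of conditioned spaces drawn independently; by a
second moment estimate (`dist_nsmul_add_le`) the fluctuation of their numbers costs only `ε n + K`.
The price per copy is thus `2|G| H(V|U)` on one side and `2|G| H(U|V)` on the other. Together these
are `2|G|` times the summand of the cost at `ι`, hence at most `2|G|` times the cost. The total is
`2|G| + 1` times the cost, and one takes the infimum over couplings.

Rounding the multiplicities makes the conditioned sequences additive only up to a bounded error.
This gives quasi-linearity, since `φ` is bounded below by `φ 1 > 0`, and existence of the limit by
Fekete's lemma. -/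

open scoped Classical in
/-- The map `h` pushes the weights `μ` forward to the weights `ν`. -/
def IsPushforward {A B : Type*} [Fintype A] (h : A → B) (μ : A → ℝ) (ν : B → ℝ) : Prop :=
  ∀ b, ∑ a, (if h a = b then μ a else 0) = ν b

/-! ### Push-forwards of weights -/

namespace IsPushforward

variable {A B C : Type*} [Fintype A]

theorem sum_mul [Fintype B] {h : A → B} {μ : A → ℝ} {ν : B → ℝ} (H : IsPushforward h μ ν) (F : B → ℝ) :
    ∑ a, μ a * F (h a) = ∑ b, ν b * F b := by
  classical
  have : ∀ b, ν b * F b = ∑ a, (if h a = b then μ a * F (h a) else 0) := by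
    intro b
    rw [← H b, Finset.sum_mul]
    refine Finset.sum_congr rfl fun a _ => ?_
    split_ifs with hab
    · rw [hab]
    · simp
  simp_rw [this]
  rw [Finset.sum_comm]
  simp

theorem sum_eq [Fintype B] {h : A → B} {μ : A → ℝ} {ν : B → ℝ} (H : IsPushforward h μ ν) :
    ∑ a, μ a = ∑ b, ν b := by
  simpa using H.sum_mul fun _ => 1

theorem le {h : A → B} {μ : A → ℝ} {ν : B → ℝ} (H : IsPushforward h μ ν) (hμ : ∀ a, 0 ≤ μ a)
    (a : A) : μ a ≤ ν (h a) := by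
  classical
  rw [← H (h a)]
  have := Finset.single_le_sum (f := fun a' => if h a' = h a then μ a' else 0)
    (fun a' _ => by split_ifs <;> simp [hμ]) (Finset.mem_univ a)
  simpa using this

theorem comp [Fintype B] {h : A → B} {g : B → C} {μ : A → ℝ} {ν : B → ℝ} {ρ : C → ℝ}
    (H : IsPushforward h μ ν) (K : IsPushforward g ν ρ) :
    IsPushforward (fun a => g (h a)) μ ρ := by
  classical
  intro c
  rw [← K c]
  simpa using H.sum_mul fun b => if g b = c then 1 else 0

theorem id (μ : A → ℝ) : IsPushforward (fun a => a) μ μ := by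
  classical
  intro a
  simp

end IsPushforward

/-! ### Entropy of partitions of a finite weighted set -/

section Entropy

variable {A B T : Type*} [Fintype A] [Fintype B] [Fintype T]

open scoped Classical in
/-- The weight of the class of `a`. -/
noncomputable def classWeight (μ : A → ℝ) (r : Setoid A) (a : A) : ℝ :=
  ∑ b, if r a b then μ b else 0

/-- The entropy of a partition of a finite weighted set. -/
noncomputable def partitionEntropy (μ : A → ℝ) (r : Setoid A) : ℝ :=
  -∑ a, μ a * Real.log (classWeight μ r a)

theorem classWeight_eq_of_rel (μ : A → ℝ) (r : Setoid A) {a b : A} (h : r a b) :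
    classWeight μ r a = classWeight μ r b := by
  classical
  refine Finset.sum_congr rfl fun c _ => ?_
  have : r a c ↔ r b c := ⟨fun k => r.trans' (r.symm' h) k, fun k => r.trans' h k⟩
  simp [this]

theorem le_classWeight {μ : A → ℝ} (hμ : ∀ a, 0 ≤ μ a) (r : Setoid A) (a : A) :
    μ a ≤ classWeight μ r a := by
  classical
  have := Finset.single_le_sum (f := fun b => if r a b then μ b else 0)
    (fun b _ => by split_ifs <;> simp [hμ]) (Finset.mem_univ a)
  rwa [if_pos (r.refl' a)] at this

theorem classWeight_pos {μ : A → ℝ} (hμ : ∀ a, 0 ≤ μ a) (r : Setoid A) {a : A} (ha : μ a ≠ 0) :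
    0 < classWeight μ r a :=
  ((hμ a).lt_of_ne' ha).trans_le (le_classWeight hμ r a)

theorem classWeight_mono {μ : A → ℝ} (hμ : ∀ a, 0 ≤ μ a) {r s : Setoid A} {a : A} (ha : μ a ≠ 0)
    (h : ∀ a b, μ a ≠ 0 → μ b ≠ 0 → r a b → s a b) : classWeight μ r a ≤ classWeight μ s a := by
  classical
  refine Finset.sum_le_sum fun b _ => ?_
  by_cases hb : μ b = 0
  · simp [hb]
  · by_cases hr : r a b
    · simp [hr, h a b ha hb hr]
    · simp only [hr, if_false]
      split_ifs <;> simp [hμ]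

/-- Larger classes have larger logarithms. Comparing the relations on points of nonzero weight is
enough, which matters for glued couplings: there the two maps to the common factor agree only on the
support. -/
theorem partitionEntropy_mono {μ : A → ℝ} (hμ : ∀ a, 0 ≤ μ a) {r s : Setoid A}
    (h : ∀ a b, μ a ≠ 0 → μ b ≠ 0 → r a b → s a b) :
    partitionEntropy μ s ≤ partitionEntropy μ r := by
  refine neg_le_neg (Finset.sum_le_sum fun a _ => ?_)
  by_cases ha : μ a = 0
  · simp [ha]
  · exact mul_le_mul_of_nonneg_left
      (Real.log_le_log (classWeight_pos hμ r ha) (classWeight_mono hμ ha h)) (hμ a)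

theorem partitionEntropy_congr {μ : A → ℝ} (hμ : ∀ a, 0 ≤ μ a) {r s : Setoid A}
    (h : ∀ a b, μ a ≠ 0 → μ b ≠ 0 → (r a b ↔ s a b)) :
    partitionEntropy μ r = partitionEntropy μ s :=
  le_antisymm (partitionEntropy_mono hμ fun a b ha hb => (h a b ha hb).2)
    (partitionEntropy_mono hμ fun a b ha hb => (h a b ha hb).1)

/-- This moves entropies of different spaces to one common space, where they can be compared as
entropies of pulled back partitions. -/
theorem partitionEntropy_comap {h : A → B} {μ : A → ℝ} {ν : B → ℝ} (H : IsPushforward h μ ν)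
    (r : Setoid B) : partitionEntropy μ (r.comap h) = partitionEntropy ν r := by
  classical
  have hc : ∀ a, classWeight μ (r.comap h) a = classWeight ν r (h a) := by
    intro a
    have := H.sum_mul fun b => if r (h a) b then 1 else 0
    simpa [classWeight, Setoid.comap_rel] using this
  simp_rw [partitionEntropy, hc]
  rw [H.sum_mul fun b => Real.log (classWeight ν r b)]

theorem classWeight_bot (μ : A → ℝ) (a : A) : classWeight μ ⊥ a = μ a := by
  classical
  simp [classWeight]

theorem partitionEntropy_bot (μ : A → ℝ) :
    partitionEntropy μ ⊥ = ∑ a, Real.negMulLog (μ a) := by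
  simp [partitionEntropy, classWeight_bot, Real.negMulLog]

theorem partitionEntropy_top {μ : A → ℝ} (h : ∑ a, μ a = 1) : partitionEntropy μ ⊤ = 0 := by
  simp [partitionEntropy, classWeight, Setoid.top_def, h]

theorem partitionEntropy_ker {V : A → T} {μ : A → ℝ} {p : T → ℝ} (H : IsPushforward V μ p) :
    partitionEntropy μ (Setoid.ker V) = ∑ t, Real.negMulLog (p t) := by
  rw [← partitionEntropy_bot, ← partitionEntropy_comap H]
  rfl

/-- The points satisfying `P` share one class, so the sum is part of the weight of that class
divided by the whole of it. A class of weight zero contributes `0 / 0 = 0`. -/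
theorem sum_weight_div_classWeight_le_one {μ : A → ℝ} (hμ : ∀ a, 0 ≤ μ a) (r : Setoid A)
    (P : A → Prop) [DecidablePred P] (hP : ∀ a b, P a → P b → r a b) :
    ∑ a, (if P a then μ a / classWeight μ r a else 0) ≤ 1 := by
  classical
  by_cases hne : ∃ a, P a
  · obtain ⟨a₀, ha₀⟩ := hne
    have h1 : ∀ a, (if P a then μ a / classWeight μ r a else 0) ≤
        (if r a₀ a then μ a else 0) / classWeight μ r a₀ := by
      intro a
      have hc : 0 ≤ classWeight μ r a₀ := (hμ a₀).trans (le_classWeight hμ r a₀)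
      by_cases ha : P a
      · rw [if_pos ha, if_pos (hP _ _ ha₀ ha), classWeight_eq_of_rel μ r (hP _ _ ha ha₀)]
      · rw [if_neg ha]
        refine div_nonneg ?_ hc
        split_ifs <;> simp [hμ]
    refine (Finset.sum_le_sum fun a _ => h1 a).trans ?_
    rw [← Finset.sum_div]
    exact div_self_le_one _
  · push Not at hne
    simp [hne]

/-- Submodularity of entropy. -/
theorem partitionEntropy_submodular {μ : A → ℝ} (hμ : ∀ a, 0 ≤ μ a) (hsum : ∑ a, μ a = 1)
    {r s t : Setoid A} (hr : ∀ a b, μ a ≠ 0 → μ b ≠ 0 → r a b → t a b)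
    (hs : ∀ a b, μ a ≠ 0 → μ b ≠ 0 → s a b → t a b) :
    partitionEntropy μ (r ⊓ s) + partitionEntropy μ t ≤
      partitionEntropy μ r + partitionEntropy μ s := by
  classical
  -- Gibbs' inequality: as `log q ≤ q - 1`, the bound `∑ μ q ≤ 1` yields `∑ μ log q ≤ 0`, which is
  -- the claim.
  set q : A → ℝ := fun a => classWeight μ r a * classWeight μ s a /
    (classWeight μ (r ⊓ s) a * classWeight μ t a) with hq
  have key : ∑ a, μ a * q a ≤ 1 := by
    have hexp : ∀ a, μ a * q a = ∑ b, ∑ c, (if r a b ∧ s a c then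
        μ a / classWeight μ (r ⊓ s) a * (μ b * μ c / classWeight μ t a) else 0) := by
      intro a
      have : classWeight μ r a * classWeight μ s a =
          ∑ b, ∑ c, if r a b ∧ s a c then μ b * μ c else 0 := by
        rw [classWeight, classWeight, Finset.sum_mul_sum]
        refine Finset.sum_congr rfl fun b _ => Finset.sum_congr rfl fun c _ => ?_
        by_cases h1 : r a b <;> by_cases h2 : s a c <;> simp [h1, h2]
      rw [hq]
      dsimp only
      rw [this, Finset.sum_div, Finset.mul_sum]
      refine Finset.sum_congr rfl fun b _ => ?_
      rw [Finset.sum_div, Finset.mul_sum]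
      refine Finset.sum_congr rfl fun c _ => ?_
      split_ifs
      · ring
      · simp
    -- If all three weights are nonzero, `b` and `c` lie in the `t`-class of `a`. The class weight
    -- of `a` can then be replaced by that of `b`, and the sum over `a` separates.
    have hle : ∀ a b c, (if r a b ∧ s a c then
        μ a / classWeight μ (r ⊓ s) a * (μ b * μ c / classWeight μ t a) else 0) ≤
        (if r a b ∧ s a c then μ a / classWeight μ (r ⊓ s) a else 0) *
          (if t b c then μ b * μ c / classWeight μ t b else 0) := by
      intro a b c
      by_cases hrs : r a b ∧ s a c
      · rw [if_pos hrs, if_pos hrs]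
        by_cases hz : μ a = 0 ∨ μ b = 0 ∨ μ c = 0
        · rcases hz with hz | hz | hz <;> simp [hz]
        · push Not at hz
          have hab := hr a b hz.1 hz.2.1 hrs.1
          have hac := hs a c hz.1 hz.2.2 hrs.2
          rw [if_pos (t.trans' (t.symm' hab) hac), classWeight_eq_of_rel μ t hab]
      · simp [hrs]
    calc ∑ a, μ a * q a
        ≤ ∑ a, ∑ b, ∑ c, (if r a b ∧ s a c then μ a / classWeight μ (r ⊓ s) a else 0) *
          (if t b c then μ b * μ c / classWeight μ t b else 0) := by
          refine Finset.sum_le_sum fun a _ => ?_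
          rw [hexp]
          exact Finset.sum_le_sum fun b _ => Finset.sum_le_sum fun c _ => hle a b c
      _ = ∑ b, ∑ c, (∑ a, if r a b ∧ s a c then μ a / classWeight μ (r ⊓ s) a else 0) *
          (if t b c then μ b * μ c / classWeight μ t b else 0) := by
          rw [Finset.sum_comm]
          refine Finset.sum_congr rfl fun b _ => ?_
          rw [Finset.sum_comm]
          refine Finset.sum_congr rfl fun c _ => ?_
          rw [Finset.sum_mul]
      _ ≤ ∑ b, ∑ c, (if t b c then μ b * μ c / classWeight μ t b else 0) := by
          refine Finset.sum_le_sum fun b _ => Finset.sum_le_sum fun c _ => ?_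
          refine mul_le_of_le_one_left ?_ ?_
          · split_ifs
            · exact div_nonneg (mul_nonneg (hμ _) (hμ _))
                ((hμ b).trans (le_classWeight hμ t b))
            · rfl
          -- For fixed `b` and `c`, the admissible `a` all lie in one class of `r ⊓ s`.
          · refine sum_weight_div_classWeight_le_one hμ (r ⊓ s) _ fun a a' ha ha' => ?_
            exact Setoid.inf_iff_and.2 ⟨r.trans' ha.1 (r.symm' ha'.1),
              s.trans' ha.2 (s.symm' ha'.2)⟩
      _ = ∑ b, μ b * (classWeight μ t b / classWeight μ t b) := by
          refine Finset.sum_congr rfl fun b _ => ?_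
          have : μ b * (classWeight μ t b / classWeight μ t b) =
              ∑ c, μ b * ((if t b c then μ c else 0) / classWeight μ t b) := by
            rw [← Finset.mul_sum, ← Finset.sum_div]
            rfl
          rw [this]
          refine Finset.sum_congr rfl fun c _ => ?_
          split_ifs
          · ring
          · simp
      _ ≤ ∑ b, μ b := Finset.sum_le_sum fun b _ =>
          mul_le_of_le_one_right (hμ b) (div_self_le_one _)
      _ = 1 := hsum
  have hterm : ∀ a, μ a * Real.log (classWeight μ r a) + μ a * Real.log (classWeight μ s a) -
      μ a * Real.log (classWeight μ (r ⊓ s) a) - μ a * Real.log (classWeight μ t a) ≤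
      μ a * q a - μ a := by
    intro a
    by_cases ha : μ a = 0
    · simp [ha]
    · have h1 := classWeight_pos hμ r ha
      have h2 := classWeight_pos hμ s ha
      have h3 := classWeight_pos hμ (r ⊓ s) ha
      have h4 := classWeight_pos hμ t ha
      have hlog : Real.log (q a) = Real.log (classWeight μ r a) + Real.log (classWeight μ s a) -
          (Real.log (classWeight μ (r ⊓ s) a) + Real.log (classWeight μ t a)) := by
        rw [hq]
        dsimp only
        rw [Real.log_div (mul_pos h1 h2).ne' (mul_pos h3 h4).ne', Real.log_mul h1.ne' h2.ne',
          Real.log_mul h3.ne' h4.ne']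
      have hqpos : 0 < q a := div_pos (mul_pos h1 h2) (mul_pos h3 h4)
      have := mul_le_mul_of_nonneg_left (Real.log_le_sub_one_of_pos hqpos) (hμ a)
      rw [hlog] at this
      linarith
  have hfin := Finset.sum_le_sum fun a (_ : a ∈ Finset.univ) => hterm a
  simp only [Finset.sum_sub_distrib, Finset.sum_add_distrib] at hfin
  simp only [partitionEntropy]
  linarith

theorem partitionEntropy_nonneg {μ : A → ℝ} (hμ : ∀ a, 0 ≤ μ a) (hsum : ∑ a, μ a = 1)
    (r : Setoid A) : 0 ≤ partitionEntropy μ r := by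
  rw [← partitionEntropy_top hsum]
  exact partitionEntropy_mono hμ fun a b _ _ _ => trivial

/-- Entropy of a product partition. -/
theorem partitionEntropy_prod {μ : A → ℝ} {ν : B → ℝ} (hμ : ∀ a, 0 ≤ μ a) (hμ1 : ∑ a, μ a = 1)
    (hν : ∀ b, 0 ≤ ν b) (hν1 : ∑ b, ν b = 1) (r : Setoid A) (s : Setoid B) :
    partitionEntropy (fun z : A × B => μ z.1 * ν z.2) (r.prod s) =
      partitionEntropy μ r + partitionEntropy ν s := by
  classical
  have hc : ∀ z : A × B, classWeight (fun z : A × B => μ z.1 * ν z.2) (r.prod s) z =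
      classWeight μ r z.1 * classWeight ν s z.2 := by
    intro z
    rw [classWeight, classWeight, classWeight, Finset.sum_mul_sum, Fintype.sum_prod_type]
    refine Finset.sum_congr rfl fun a _ => Finset.sum_congr rfl fun b _ => ?_
    have : (r.prod s) z (a, b) ↔ r z.1 a ∧ s z.2 b := Iff.rfl
    by_cases h1 : r z.1 a <;> by_cases h2 : s z.2 b <;> simp [this, h1, h2]
  have hterm : ∀ z : A × B, μ z.1 * ν z.2 * Real.log (classWeight μ r z.1 * classWeight ν s z.2) =
      (μ z.1 * Real.log (classWeight μ r z.1)) * ν z.2 +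
        μ z.1 * (ν z.2 * Real.log (classWeight ν s z.2)) := by
    intro z
    by_cases h1 : μ z.1 = 0
    · simp [h1]
    by_cases h2 : ν z.2 = 0
    · simp [h2]
    rw [Real.log_mul (classWeight_pos hμ r h1).ne' (classWeight_pos hν s h2).ne']
    ring
  simp only [partitionEntropy, hc, hterm]
  rw [Finset.sum_add_distrib, Fintype.sum_prod_type, Fintype.sum_prod_type]
  simp only [← Finset.mul_sum, ← Finset.sum_mul, hμ1, hν1]
  ring

/-- The chain rule for a mixture. -/
theorem partitionEntropy_sigma {C : T → Type*} [∀ t, Fintype (C t)] {p : T → ℝ}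
    {μ : ∀ t, C t → ℝ} (hμ : ∀ t c, 0 ≤ μ t c) (hμ1 : ∀ t, ∑ c, μ t c = 1)
    (r : Setoid (Σ t, C t)) :
    partitionEntropy (fun z : Σ t, C t => p z.1 * μ z.1 z.2)
        (r ⊓ Setoid.ker (Sigma.fst : (Σ t, C t) → T)) =
      ∑ t, Real.negMulLog (p t) + ∑ t, p t * partitionEntropy (μ t) (r.comap (Sigma.mk t)) := by
  classical
  have hc : ∀ t (c : C t), classWeight (fun z : Σ t, C t => p z.1 * μ z.1 z.2)
      (r ⊓ Setoid.ker (Sigma.fst : (Σ t, C t) → T)) ⟨t, c⟩ =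
      p t * classWeight (μ t) (r.comap (Sigma.mk t)) c := by
    intro t c
    rw [classWeight, classWeight, Fintype.sum_sigma, Finset.mul_sum]
    rw [Finset.sum_eq_single t]
    · refine Finset.sum_congr rfl fun d _ => ?_
      by_cases h : r ⟨t, c⟩ ⟨t, d⟩ <;> simp [Setoid.inf_iff_and, Setoid.ker_def, Setoid.comap_rel, h]
    · intro t' _ ht'
      refine Finset.sum_eq_zero fun d _ => if_neg ?_
      simp only [Setoid.inf_iff_and, Setoid.ker_def, not_and]
      exact fun _ h => ht' h.symm
    · simp
  have hterm : ∀ t (c : C t), p t * μ t c *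
      Real.log (p t * classWeight (μ t) (r.comap (Sigma.mk t)) c) =
      (p t * Real.log (p t)) * μ t c +
        p t * (μ t c * Real.log (classWeight (μ t) (r.comap (Sigma.mk t)) c)) := by
    intro t c
    by_cases h1 : p t = 0
    · simp [h1]
    by_cases h2 : μ t c = 0
    · simp [h2]
    rw [Real.log_mul h1 (classWeight_pos (hμ t) _ h2).ne']
    ring
  simp only [partitionEntropy]
  rw [Fintype.sum_sigma]
  simp only [hc, hterm, Finset.sum_add_distrib, ← Finset.mul_sum, hμ1, Real.negMulLog]
  simp only [neg_mul, mul_neg, Finset.sum_neg_distrib, mul_one, neg_add]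

end Entropy

/-! ### Partitioned spaces, couplings and the entropy distance -/

/-- A finite probability space with a family of partitions indexed by `G`. -/
structure PartitionedSpace (G : Type v) : Type (max v (u + 1)) where
  carrier : Type u
  [fintype : Fintype carrier]
  weight : carrier → ℝ
  nonneg : ∀ a, 0 ≤ weight a
  sum_eq_one : ∑ a, weight a = 1
  partition : G → Setoid carrier

namespace PartitionedSpace

attribute [instance] fintype

variable {G : Type v}

/-- The entropy of the partition at `i`. -/
noncomputable def entropy (A : PartitionedSpace.{u} G) (i : G) : ℝ :=
  partitionEntropy A.weight (A.partition i)

/-- A coupling of two partitioned spaces. -/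
structure Coupling (A B : PartitionedSpace.{u} G) : Type (u + 1) where
  carrier : Type u
  [fintype : Fintype carrier]
  weight : carrier → ℝ
  nonneg : ∀ a, 0 ≤ weight a
  fst : carrier → A.carrier
  snd : carrier → B.carrier
  pushforward_fst : IsPushforward fst weight A.weight
  pushforward_snd : IsPushforward snd weight B.weight

namespace Coupling

attribute [instance] fintype

variable {A B C : PartitionedSpace.{u} G}

/-- The joint partition of a coupling. -/
def joint (c : Coupling A B) (i : G) : Setoid c.carrier :=
  (A.partition i).comap c.fst ⊓ (B.partition i).comap c.snd

theorem joint_rel (c : Coupling A B) (i : G) (x y : c.carrier) :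
    c.joint i x y ↔ A.partition i (c.fst x) (c.fst y) ∧ B.partition i (c.snd x) (c.snd y) :=
  Setoid.inf_iff_and

/-- The entropy of the joint partition. -/
noncomputable def jointEntropy (c : Coupling A B) (i : G) : ℝ :=
  partitionEntropy c.weight (c.joint i)

theorem sum_eq_one (c : Coupling A B) : ∑ a, c.weight a = 1 :=
  c.pushforward_fst.sum_eq.trans A.sum_eq_one

theorem entropy_fst (c : Coupling A B) (i : G) :
    partitionEntropy c.weight ((A.partition i).comap c.fst) = A.entropy i :=
  partitionEntropy_comap c.pushforward_fst _

theorem entropy_snd (c : Coupling A B) (i : G) :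
    partitionEntropy c.weight ((B.partition i).comap c.snd) = B.entropy i :=
  partitionEntropy_comap c.pushforward_snd _

theorem fst_le_jointEntropy (c : Coupling A B) (i : G) : A.entropy i ≤ c.jointEntropy i := by
  rw [← c.entropy_fst]
  exact partitionEntropy_mono c.nonneg fun a b _ _ h => ((c.joint_rel i a b).1 h).1

theorem snd_le_jointEntropy (c : Coupling A B) (i : G) : B.entropy i ≤ c.jointEntropy i := by
  rw [← c.entropy_snd]
  exact partitionEntropy_mono c.nonneg fun a b _ _ h => ((c.joint_rel i a b).1 h).2

/-- The coupling with the roles of the two spaces exchanged. -/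
def symm (c : Coupling A B) : Coupling B A where
  carrier := c.carrier
  weight := c.weight
  nonneg := c.nonneg
  fst := c.snd
  snd := c.fst
  pushforward_fst := c.pushforward_snd
  pushforward_snd := c.pushforward_fst

theorem jointEntropy_symm (c : Coupling A B) (i : G) :
    c.symm.jointEntropy i = c.jointEntropy i :=
  partitionEntropy_congr c.nonneg fun a b _ _ =>
    (c.symm.joint_rel i a b).trans (and_comm.trans (c.joint_rel i a b).symm)

/-- The coupling given by a measure-preserving map. -/
def ofMap (h : A.carrier → B.carrier) (H : IsPushforward h A.weight B.weight) : Coupling A B where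
  carrier := A.carrier
  weight := A.weight
  nonneg := A.nonneg
  fst := fun a => a
  snd := h
  pushforward_fst := .id _
  pushforward_snd := H

theorem isPushforward_prodFst {X Y : Type*} [Fintype X] [Fintype Y] {μ : X → ℝ} {ν : Y → ℝ}
    (hν : ∑ y, ν y = 1) : IsPushforward Prod.fst (fun z : X × Y => μ z.1 * ν z.2) μ := by
  classical
  intro x
  rw [Fintype.sum_prod_type]
  rw [Finset.sum_eq_single x]
  · simp [← Finset.mul_sum, hν]
  · intro y _ hy
    simp [hy]
  · simp

theorem isPushforward_prodMap {X Y X' Y' : Type*} [Fintype X] [Fintype Y]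
    {μ : X → ℝ} {ν : Y → ℝ} {μ' : X' → ℝ} {ν' : Y' → ℝ} {f : X → X'} {g : Y → Y'}
    (hf : IsPushforward f μ μ') (hg : IsPushforward g ν ν') :
    IsPushforward (Prod.map f g) (fun z : X × Y => μ z.1 * ν z.2)
      (fun z : X' × Y' => μ' z.1 * ν' z.2) := by
  classical
  rintro ⟨x, y⟩
  dsimp only
  rw [← hf x, ← hg y, Finset.sum_mul_sum, Fintype.sum_prod_type]
  refine Finset.sum_congr rfl fun a _ => Finset.sum_congr rfl fun b _ => ?_
  by_cases h1 : f a = x <;> by_cases h2 : g b = y <;> simp [h1, h2]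

theorem isPushforward_equiv {X Y : Type*} [Fintype X] (e : X ≃ Y) {μ : X → ℝ}
    {ν : Y → ℝ} (h : ∀ x, ν (e x) = μ x) : IsPushforward e μ ν := by
  classical
  intro y
  obtain ⟨x, rfl⟩ := e.surjective y
  simp [h]

theorem isPushforward_prodSnd {X Y : Type*} [Fintype X] [Fintype Y] {μ : X → ℝ} {ν : Y → ℝ}
    (hμ : ∑ x, μ x = 1) : IsPushforward Prod.snd (fun z : X × Y => μ z.1 * ν z.2) ν :=
  (isPushforward_equiv (Equiv.prodComm X Y) (μ := fun z : X × Y => μ z.1 * ν z.2)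
    (ν := fun z : Y × X => ν z.1 * μ z.2) fun _ => mul_comm _ _).comp (isPushforward_prodFst hμ)

/-- The independent coupling. -/
noncomputable def indep (A B : PartitionedSpace.{u} G) : Coupling A B where
  carrier := A.carrier × B.carrier
  weight z := A.weight z.1 * B.weight z.2
  nonneg _ := mul_nonneg (A.nonneg _) (B.nonneg _)
  fst := Prod.fst
  snd := Prod.snd
  pushforward_fst := isPushforward_prodFst B.sum_eq_one
  pushforward_snd := isPushforward_prodSnd A.sum_eq_one

open scoped Classical in
/-- The weights of the relatively independent coupling over a common image. -/
noncomputable def glueWeight (c : Coupling A B) (d : Coupling B C) :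
    c.carrier × d.carrier → ℝ := fun z =>
  if c.snd z.1 = d.fst z.2 then c.weight z.1 * d.weight z.2 / B.weight (c.snd z.1) else 0

theorem glueWeight_nonneg (c : Coupling A B) (d : Coupling B C) (z : c.carrier × d.carrier) :
    0 ≤ glueWeight c d z := by
  classical
  rw [glueWeight]
  split_ifs
  · exact div_nonneg (mul_nonneg (c.nonneg _) (d.nonneg _)) (B.nonneg _)
  · rfl

theorem eq_of_glueWeight_ne_zero {c : Coupling A B} {d : Coupling B C} {z : c.carrier × d.carrier}
    (h : glueWeight c d z ≠ 0) : c.snd z.1 = d.fst z.2 := by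
  classical
  by_contra h'
  exact h (if_neg h')

theorem glueWeight_fst (c : Coupling A B) (d : Coupling B C) :
    IsPushforward Prod.fst (glueWeight c d) c.weight := by
  classical
  intro x
  rw [Fintype.sum_prod_type, Finset.sum_eq_single x]
  · have h : ∀ y, (if x = x then glueWeight c d (x, y) else 0) =
        (if d.fst y = c.snd x then d.weight y else 0) * (c.weight x / B.weight (c.snd x)) := by
      intro y
      rw [if_pos rfl, glueWeight]
      by_cases hy : d.fst y = c.snd x
      · simp only [hy, if_true]
        ring
      · simp [hy, Ne.symm hy]
    rw [Finset.sum_congr rfl fun y _ => h y]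
    rw [← Finset.sum_mul, d.pushforward_fst]
    -- Over a point of weight zero the division returns `0`, which is right because `x` then has
    -- weight zero too.
    by_cases h0 : B.weight (c.snd x) = 0
    · have := c.pushforward_snd.le c.nonneg x
      have h1 := c.nonneg x
      rw [h0] at this ⊢
      linarith
    · field_simp
  · intro y _ hy
    simp [hy]
  · simp

theorem glueWeight_snd (c : Coupling A B) (d : Coupling B C) :
    IsPushforward Prod.snd (glueWeight c d) d.weight := by
  refine (isPushforward_equiv (Equiv.prodComm _ _) (μ := glueWeight c d)
    (ν := glueWeight d.symm c.symm) fun z => ?_).comp (glueWeight_fst d.symm c.symm)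
  classical
  simp only [glueWeight, symm, Equiv.prodComm_apply, Prod.fst_swap, Prod.snd_swap]
  by_cases h : c.snd z.1 = d.fst z.2
  · simp [h, mul_comm]
  · simp [h, Ne.symm h]

/-- The composition of two couplings, relatively independent over the common factor. -/
noncomputable def trans (c : Coupling A B) (d : Coupling B C) : Coupling A C where
  carrier := c.carrier × d.carrier
  weight := glueWeight c d
  nonneg := glueWeight_nonneg c d
  fst := fun z => c.fst z.1
  snd := fun z => d.snd z.2
  pushforward_fst := (glueWeight_fst c d).comp c.pushforward_fst
  pushforward_snd := (glueWeight_snd c d).comp d.pushforward_snd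

/-- Submodularity on the glued space, for the two joint partitions and the partition of the common
factor, which is coarser than both. The joint partition of `A` and `C` is coarser than the meet of
the two. -/
theorem jointEntropy_trans (c : Coupling A B) (d : Coupling B C) (i : G) :
    (c.trans d).jointEntropy i + B.entropy i ≤ c.jointEntropy i + d.jointEntropy i := by
  have h1 : partitionEntropy (glueWeight c d) ((c.joint i).comap Prod.fst) = c.jointEntropy i :=
    partitionEntropy_comap (glueWeight_fst c d) _
  have h2 : partitionEntropy (glueWeight c d) ((d.joint i).comap Prod.snd) = d.jointEntropy i :=
    partitionEntropy_comap (glueWeight_snd c d) _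
  have h3 : partitionEntropy (glueWeight c d) ((B.partition i).comap fun z => c.snd z.1) =
      B.entropy i :=
    partitionEntropy_comap ((glueWeight_fst c d).comp c.pushforward_snd) _
  have hsum : ∑ z, glueWeight c d z = 1 := (c.trans d).sum_eq_one
  rw [← h1, ← h2, ← h3]
  refine le_trans (add_le_add_left (partitionEntropy_mono (glueWeight_nonneg c d) ?_) _)
    (partitionEntropy_submodular (glueWeight_nonneg c d) hsum ?_ ?_)
  · intro a b _ _ h
    obtain ⟨h, h'⟩ := Setoid.inf_iff_and.1 h
    exact ((c.trans d).joint_rel i a b).2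
      ⟨((c.joint_rel i _ _).1 h).1, ((d.joint_rel i _ _).1 h').2⟩
  · intro a b _ _ h
    rw [Setoid.comap_rel, joint_rel] at h
    exact h.2
  -- The common partition is pulled back through `c`; it agrees with the one pulled back through `d`
  -- only on the support of the gluing.
  · intro a b ha hb h
    rw [Setoid.comap_rel, joint_rel] at h
    rw [Setoid.comap_rel, eq_of_glueWeight_ne_zero ha, eq_of_glueWeight_ne_zero hb]
    exact h.1

variable [Fintype G]

/-- The entropy distance of a coupling. -/
noncomputable def cost (c : Coupling A B) : ℝ :=
  ∑ i, (2 * c.jointEntropy i - A.entropy i - B.entropy i)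

theorem cost_nonneg (c : Coupling A B) : 0 ≤ c.cost :=
  Finset.sum_nonneg fun i _ => by
    have := c.fst_le_jointEntropy i
    have := c.snd_le_jointEntropy i
    linarith

theorem cost_symm (c : Coupling A B) : c.symm.cost = c.cost :=
  Finset.sum_congr rfl fun i _ => by
    rw [jointEntropy_symm]
    ring

theorem cost_trans_le (c : Coupling A B) (d : Coupling B C) :
    (c.trans d).cost ≤ c.cost + d.cost := by
  rw [cost, cost, cost, ← Finset.sum_add_distrib]
  refine Finset.sum_le_sum fun i _ => ?_
  linarith [jointEntropy_trans c d i]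

theorem cost_ofMap (h : A.carrier → B.carrier) (H : IsPushforward h A.weight B.weight)
    (hp : ∀ i a a', A.weight a ≠ 0 → A.weight a' ≠ 0 → (A.partition i a a' ↔
      B.partition i (h a) (h a'))) :
    (ofMap h H).cost = 0 := by
  refine Finset.sum_eq_zero fun i _ => ?_
  have h1 : (ofMap h H).jointEntropy i = A.entropy i :=
    partitionEntropy_congr A.nonneg fun a b ha hb =>
      ((ofMap h H).joint_rel i a b).trans
        ⟨fun k => k.1, fun k => ⟨k, (hp i a b ha hb).1 k⟩⟩
  have h2 : B.entropy i = A.entropy i := by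
    rw [← (ofMap h H).entropy_snd]
    exact partitionEntropy_congr A.nonneg fun a b ha hb => (hp i a b ha hb).symm
  rw [h1, h2]
  ring

end Coupling

variable [Fintype G]

/-- The entropy distance of partitioned spaces. -/
noncomputable def edist (A B : PartitionedSpace.{u} G) : ℝ := ⨅ c : Coupling A B, c.cost

theorem bddBelow_cost (A B : PartitionedSpace.{u} G) :
    BddBelow (Set.range fun c : Coupling A B => c.cost) :=
  ⟨0, by rintro _ ⟨c, rfl⟩; exact c.cost_nonneg⟩

instance (A B : PartitionedSpace.{u} G) : Nonempty (Coupling A B) := ⟨.indep A B⟩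

theorem edist_le (A B : PartitionedSpace.{u} G) (c : Coupling A B) : edist A B ≤ c.cost :=
  ciInf_le (bddBelow_cost A B) c

theorem edist_nonneg (A B : PartitionedSpace.{u} G) : 0 ≤ edist A B :=
  Real.iInf_nonneg fun c => c.cost_nonneg

theorem exists_cost_lt (A B : PartitionedSpace.{u} G) {ε : ℝ} (hε : 0 < ε) :
    ∃ c : Coupling A B, c.cost < edist A B + ε :=
  exists_lt_of_ciInf_lt (lt_add_of_pos_right _ hε)

theorem edist_comm (A B : PartitionedSpace.{u} G) : edist A B = edist B A :=
  le_antisymm (le_ciInf fun c => c.cost_symm ▸ edist_le A B c.symm)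
    (le_ciInf fun c => c.cost_symm ▸ edist_le B A c.symm)

theorem edist_triangle (A B C : PartitionedSpace.{u} G) :
    edist A C ≤ edist A B + edist B C := by
  refine le_of_forall_pos_le_add fun ε hε => ?_
  obtain ⟨c, hc⟩ := exists_cost_lt A B (half_pos hε)
  obtain ⟨d, hd⟩ := exists_cost_lt B C (half_pos hε)
  linarith [edist_le A C (c.trans d), c.cost_trans_le d]

/-- The graph of the map is a coupling of cost zero. Injectivity is not needed: only the partitions
count, and points of weight zero are ignored. The identities between classes of spaces all come from
this. -/
theorem edist_eq_zero_of_map {A B : PartitionedSpace.{u} G} (h : A.carrier → B.carrier)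
    (H : IsPushforward h A.weight B.weight)
    (hp : ∀ i a a', A.weight a ≠ 0 → A.weight a' ≠ 0 → (A.partition i a a' ↔
      B.partition i (h a) (h a'))) : edist A B = 0 :=
  le_antisymm ((edist_le A B (.ofMap h H)).trans_eq (Coupling.cost_ofMap h H hp))
    (edist_nonneg A B)

theorem edist_self (A : PartitionedSpace.{u} G) : edist A A = 0 :=
  edist_eq_zero_of_map (fun a => a) (.id _) fun _ _ _ _ _ => Iff.rfl

/-! ### Independent products -/

section Tensor

omit [Fintype G]

/-- The independent product. -/
noncomputable def tensor (A B : PartitionedSpace.{u} G) : PartitionedSpace.{u} G where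
  carrier := A.carrier × B.carrier
  weight z := A.weight z.1 * B.weight z.2
  nonneg _ := mul_nonneg (A.nonneg _) (B.nonneg _)
  sum_eq_one := (Coupling.indep A B).sum_eq_one
  partition i := (A.partition i).prod (B.partition i)

/-- The one-point space. -/
def one (G : Type v) : PartitionedSpace.{u} G where
  carrier := PUnit
  weight _ := 1
  nonneg _ := zero_le_one
  sum_eq_one := by simp
  partition _ := ⊤

theorem entropy_tensor (A B : PartitionedSpace.{u} G) (i : G) :
    (A.tensor B).entropy i = A.entropy i + B.entropy i :=
  partitionEntropy_prod A.nonneg A.sum_eq_one B.nonneg B.sum_eq_one _ _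

/-- The independent product of couplings. -/
noncomputable def Coupling.tensor {A A' B B' : PartitionedSpace.{u} G} (c : Coupling A A')
    (d : Coupling B B') : Coupling (A.tensor B) (A'.tensor B') where
  carrier := c.carrier × d.carrier
  weight z := c.weight z.1 * d.weight z.2
  nonneg _ := mul_nonneg (c.nonneg _) (d.nonneg _)
  fst := Prod.map c.fst d.fst
  snd := Prod.map c.snd d.snd
  pushforward_fst := isPushforward_prodMap c.pushforward_fst d.pushforward_fst
  pushforward_snd := isPushforward_prodMap c.pushforward_snd d.pushforward_snd

theorem Coupling.jointEntropy_tensor {A A' B B' : PartitionedSpace.{u} G} (c : Coupling A A')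
    (d : Coupling B B') (i : G) :
    (c.tensor d).jointEntropy i = c.jointEntropy i + d.jointEntropy i := by
  rw [jointEntropy, jointEntropy, jointEntropy,
    ← partitionEntropy_prod c.nonneg c.sum_eq_one d.nonneg d.sum_eq_one]
  refine partitionEntropy_congr (c.tensor d).nonneg fun a b _ _ => ?_
  refine ((c.tensor d).joint_rel i a b).trans (Iff.trans and_and_and_comm ?_)
  exact (and_congr (c.joint_rel i a.1 b.1) (d.joint_rel i a.2 b.2)).symm

end Tensor

/-- The cost is additive on independent products of couplings. -/
theorem edist_tensor_le (A A' B B' : PartitionedSpace.{u} G) :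
    edist (A.tensor B) (A'.tensor B') ≤ edist A A' + edist B B' := by
  refine le_of_forall_pos_le_add fun ε hε => ?_
  obtain ⟨c, hc⟩ := exists_cost_lt A A' (half_pos hε)
  obtain ⟨d, hd⟩ := exists_cost_lt B B' (half_pos hε)
  have : (c.tensor d).cost = c.cost + d.cost := by
    rw [Coupling.cost, Coupling.cost, Coupling.cost, ← Finset.sum_add_distrib]
    refine Finset.sum_congr rfl fun i _ => ?_
    rw [Coupling.jointEntropy_tensor, entropy_tensor, entropy_tensor]
    ring
  linarith [edist_le _ _ (c.tensor d)]

theorem edist_tensor_comm (A B : PartitionedSpace.{u} G) :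
    edist (A.tensor B) (B.tensor A) = 0 :=
  edist_eq_zero_of_map (Equiv.prodComm _ _)
    (Coupling.isPushforward_equiv _ fun _ => mul_comm _ _) fun _ _ _ _ _ => and_comm

theorem edist_tensor_assoc (A B C : PartitionedSpace.{u} G) :
    edist ((A.tensor B).tensor C) (A.tensor (B.tensor C)) = 0 :=
  edist_eq_zero_of_map (Equiv.prodAssoc _ _ _)
    (Coupling.isPushforward_equiv _ fun _ => (mul_assoc _ _ _).symm) fun _ _ _ _ _ => and_assoc

theorem edist_tensor_one (A : PartitionedSpace.{u} G) : edist (A.tensor (one G)) A = 0 :=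
  edist_eq_zero_of_map Prod.fst (Coupling.isPushforward_prodFst (one G).sum_eq_one)
    fun _ _ _ _ _ => and_iff_left trivial

end PartitionedSpace

/-! ### Conditioning and the chain rule -/

section Conditioning

variable {A B S T : Type*} [Fintype A]

open scoped Classical in
/-- The weight of the fiber of `V` over `t`. -/
noncomputable def fiberWeight (μ : A → ℝ) (V : A → T) (t : T) : ℝ :=
  ∑ a, if V a = t then μ a else 0

open scoped Classical in
/-- The weights conditioned on the fiber of `V` over `t`; a fiber of weight zero is ignored. -/
noncomputable def condWeight (μ : A → ℝ) (V : A → T) (t : T) (a : A) : ℝ :=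
  if fiberWeight μ V t = 0 then μ a else if V a = t then μ a / fiberWeight μ V t else 0

theorem isPushforward_fiberWeight (μ : A → ℝ) (V : A → T) :
    IsPushforward V μ (fiberWeight μ V) := fun _ => rfl

theorem fiberWeight_nonneg {μ : A → ℝ} (hμ : ∀ a, 0 ≤ μ a) (V : A → T) (t : T) :
    0 ≤ fiberWeight μ V t := by
  classical
  refine Finset.sum_nonneg fun a _ => ?_
  split_ifs <;> simp [hμ]

theorem sum_fiberWeight [Fintype T] (μ : A → ℝ) (V : A → T) :
    ∑ t, fiberWeight μ V t = ∑ a, μ a :=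
  (isPushforward_fiberWeight μ V).sum_eq.symm

theorem condWeight_nonneg {μ : A → ℝ} (hμ : ∀ a, 0 ≤ μ a) (V : A → T) (t : T) (a : A) :
    0 ≤ condWeight μ V t a := by
  classical
  rw [condWeight]
  split_ifs
  · exact hμ a
  · exact div_nonneg (hμ a) (fiberWeight_nonneg hμ V t)
  · rfl

theorem sum_condWeight {μ : A → ℝ} (hμ1 : ∑ a, μ a = 1) (V : A → T) (t : T) :
    ∑ a, condWeight μ V t a = 1 := by
  classical
  by_cases h : fiberWeight μ V t = 0
  · simp [condWeight, h, hμ1]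
  · have : ∀ a, condWeight μ V t a = (if V a = t then μ a else 0) / fiberWeight μ V t := by
      intro a
      rw [condWeight, if_neg h]
      split_ifs <;> simp
    simp only [this]
    rw [← Finset.sum_div]
    exact div_self h

/-- The formula survives on fibers of weight zero, so the arbitrary value of `condWeight` there
disappears from every average over fibers. -/
theorem fiberWeight_mul_condWeight [DecidableEq T] {μ : A → ℝ} (hμ : ∀ a, 0 ≤ μ a) (V : A → T)
    (t : T) (a : A) :
    fiberWeight μ V t * condWeight μ V t a = if V a = t then μ a else 0 := by
  classical
  by_cases h : fiberWeight μ V t = 0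
  · rw [h, zero_mul]
    split_ifs with hV
    · have := (isPushforward_fiberWeight μ V).le hμ a
      rw [hV, h] at this
      exact (hμ a).antisymm this
    · rfl
  · rw [condWeight, if_neg h]
    by_cases hV : V a = t
    · simp only [hV, if_true]
      field_simp
    · simp [hV]

theorem condWeight_eq_of_mul_eq {μ : A → ℝ} (hμ : ∀ a, 0 ≤ μ a) {V : A → T} {t : T} {x : ℝ}
    {a : A} (ht : fiberWeight μ V t ≠ 0)
    (h : ∀ [DecidableEq T], fiberWeight μ V t * x = if V a = t then μ a else 0) :
    condWeight μ V t a = x := by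
  classical
  refine mul_left_cancel₀ ht ?_
  rw [h, fiberWeight_mul_condWeight hμ]

theorem fiberWeight_comp {h : A → B} [Fintype B] {μ : A → ℝ} {ν : B → ℝ}
    (H : IsPushforward h μ ν) (V : B → T) (t : T) :
    fiberWeight μ (fun a => V (h a)) t = fiberWeight ν V t := by
  classical
  simpa [fiberWeight] using H.sum_mul fun b => if V b = t then 1 else 0

theorem isPushforward_condWeight {h : A → B} [Fintype B] {μ : A → ℝ} {ν : B → ℝ}
    (H : IsPushforward h μ ν) (V : B → T) (t : T) :
    IsPushforward h (condWeight μ (fun a => V (h a)) t) (condWeight ν V t) := by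
  classical
  intro b
  by_cases h0 : fiberWeight ν V t = 0
  · simpa [condWeight, fiberWeight_comp H, h0] using H b
  · simp only [condWeight, fiberWeight_comp H, h0, if_false]
    by_cases hb : V b = t
    · rw [if_pos hb, ← H b, Finset.sum_div]
      refine Finset.sum_congr rfl fun a _ => ?_
      by_cases ha : h a = b
      · simp [ha, hb]
      · simp [ha]
    · rw [if_neg hb]
      refine Finset.sum_eq_zero fun a _ => ?_
      by_cases ha : h a = b
      · simp [ha, hb]
      · simp [ha]

/-- The chain rule. -/
theorem partitionEntropy_inf_ker [Fintype T] {μ : A → ℝ} (hμ : ∀ a, 0 ≤ μ a)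
    (hμ1 : ∑ a, μ a = 1) (V : A → T) (r : Setoid A) :
    partitionEntropy μ (r ⊓ Setoid.ker V) = ∑ t, Real.negMulLog (fiberWeight μ V t) +
      ∑ t, fiberWeight μ V t * partitionEntropy (condWeight μ V t) r := by
  classical
  -- The space is the image of the mixture of its conditioned versions. On the support of the
  -- mixture the index is the value of `V`, so the partition by the index is the pullback of
  -- `Setoid.ker V`.
  have key := partitionEntropy_sigma (C := fun _ : T => A) (p := fiberWeight μ V)
    (condWeight_nonneg hμ V) (sum_condWeight hμ1 V) (r.comap Sigma.snd)
  have hpush : IsPushforward (Sigma.snd : (Σ _ : T, A) → A)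
      (fun z : Σ _ : T, A => fiberWeight μ V z.1 * condWeight μ V z.1 z.2) μ := by
    intro a
    rw [Fintype.sum_sigma]
    simp [fiberWeight_mul_condWeight hμ]
  rw [← partitionEntropy_comap hpush]
  refine (partitionEntropy_congr (fun z => mul_nonneg (fiberWeight_nonneg hμ V _)
    (condWeight_nonneg hμ V _ _)) fun z w hz hw => ?_).trans key
  have hV : ∀ z : Σ _ : T, A, fiberWeight μ V z.1 * condWeight μ V z.1 z.2 ≠ 0 → V z.2 = z.1 := by
    intro z hz
    by_contra hne
    exact hz (by rw [fiberWeight_mul_condWeight hμ, if_neg hne])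
  rw [Setoid.comap_rel, Setoid.inf_iff_and, Setoid.inf_iff_and, Setoid.comap_rel, Setoid.ker_def,
    Setoid.ker_def, hV z hz, hV w hw]
  rfl

/-- Conditioning does not increase entropy on average: the chain rule and submodularity over the
trivial partition. -/
theorem sum_fiberWeight_mul_partitionEntropy_le [Fintype T] {μ : A → ℝ} (hμ : ∀ a, 0 ≤ μ a)
    (hμ1 : ∑ a, μ a = 1) (V : A → T) (r : Setoid A) :
    ∑ t, fiberWeight μ V t * partitionEntropy (condWeight μ V t) r ≤ partitionEntropy μ r := by
  have h1 := partitionEntropy_inf_ker hμ hμ1 V r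
  have h2 := partitionEntropy_submodular hμ hμ1 (r := r) (s := Setoid.ker V) (t := ⊤)
    (fun _ _ _ _ _ => trivial) fun _ _ _ _ _ => trivial
  rw [partitionEntropy_top hμ1, partitionEntropy_ker (isPushforward_fiberWeight μ V)] at h2
  linarith

theorem fiberWeight_prod {μ : A → ℝ} (hμ : ∀ a, 0 ≤ μ a) (U : A → S) (V : A → T) (s : S) (t : T) :
    fiberWeight μ (fun a => (U a, V a)) (s, t) =
      fiberWeight μ U s * fiberWeight (condWeight μ U s) V t := by
  classical
  rw [fiberWeight, fiberWeight.eq_def (condWeight μ U s), Finset.mul_sum]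
  refine Finset.sum_congr rfl fun a _ => ?_
  rw [mul_ite, fiberWeight_mul_condWeight hμ]
  by_cases h1 : U a = s <;> by_cases h2 : V a = t <;> simp [h1, h2]

/-- The joint fiber must have nonzero weight: otherwise the right side is by convention the
unconditioned `μ`. -/
theorem condWeight_condWeight {μ : A → ℝ} (hμ : ∀ a, 0 ≤ μ a) (U : A → S) (V : A → T) (s : S)
    (t : T) (h : fiberWeight μ (fun a => (U a, V a)) (s, t) ≠ 0) :
    condWeight (condWeight μ U s) V t = condWeight μ (fun a => (U a, V a)) (s, t) := by
  classical
  funext a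
  refine (condWeight_eq_of_mul_eq hμ h ?_).symm
  rw [fiberWeight_prod hμ, mul_assoc, fiberWeight_mul_condWeight (condWeight_nonneg hμ U s),
    mul_ite, fiberWeight_mul_condWeight hμ]
  by_cases h1 : U a = s <;> by_cases h2 : V a = t <;> simp [h1, h2]

end Conditioning

/-! ### Mixtures of couplings -/

namespace PartitionedSpace

variable {G : Type v}

/-- The space conditioned on the fiber of `V` over `t`. -/
noncomputable def cond (A : PartitionedSpace.{u} G) {T : Type*} (V : A.carrier → T) (t : T) :
    PartitionedSpace.{u} G where
  carrier := A.carrier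
  weight := condWeight A.weight V t
  nonneg := condWeight_nonneg A.nonneg V t
  sum_eq_one := sum_condWeight A.sum_eq_one V t
  partition := A.partition

/-- The mixture of couplings of the conditioned spaces with a fixed space. -/
noncomputable def Coupling.mix {A B : PartitionedSpace.{u} G} {T : Type u} [Fintype T]
    (V : A.carrier → T) (c : ∀ t, Coupling (A.cond V t) B) : Coupling A B where
  carrier := Σ t, (c t).carrier
  weight z := fiberWeight A.weight V z.1 * (c z.1).weight z.2
  nonneg z := mul_nonneg (fiberWeight_nonneg A.nonneg V _) ((c z.1).nonneg _)
  fst z := (c z.1).fst z.2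
  snd z := (c z.1).snd z.2
  pushforward_fst := by
    classical
    intro (a : A.carrier)
    rw [Fintype.sum_sigma]
    have h : ∀ t, ∑ z, (if (c t).fst z = a then fiberWeight A.weight V t * (c t).weight z else 0) =
        if V a = t then A.weight a else 0 := by
      intro t
      have := (c t).pushforward_fst a
      rw [← fiberWeight_mul_condWeight A.nonneg]
      refine Eq.trans ?_ (congrArg (fiberWeight A.weight V t * ·) this)
      rw [Finset.mul_sum]
      exact Finset.sum_congr rfl fun z _ => by split_ifs <;> simp
    refine (Finset.sum_congr rfl fun t _ => h t).trans ?_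
    simp
  pushforward_snd := by
    classical
    intro b
    rw [Fintype.sum_sigma]
    have h : ∀ t, ∑ z, (if (c t).snd z = b then fiberWeight A.weight V t * (c t).weight z else 0) =
        fiberWeight A.weight V t * B.weight b := by
      intro t
      rw [← (c t).pushforward_snd b, Finset.mul_sum]
      exact Finset.sum_congr rfl fun z _ => by split_ifs <;> simp
    refine (Finset.sum_congr rfl fun t _ => h t).trans ?_
    rw [← Finset.sum_mul, sum_fiberWeight, A.sum_eq_one, one_mul]

/-- Recording the index `t` as well only refines the joint partition, and the chain rule computes
the refined entropy. -/
theorem Coupling.jointEntropy_mix_le {A B : PartitionedSpace.{u} G} {T : Type u} [Fintype T]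
    (V : A.carrier → T) (c : ∀ t, Coupling (A.cond V t) B) (i : G) :
    (Coupling.mix V c).jointEntropy i ≤ ∑ t, Real.negMulLog (fiberWeight A.weight V t) +
      ∑ t, fiberWeight A.weight V t * (c t).jointEntropy i := by
  refine le_trans (partitionEntropy_mono (Coupling.mix V c).nonneg ?_)
    (partitionEntropy_sigma (C := fun t => (c t).carrier) (fun t => (c t).nonneg)
      (fun t => (c t).sum_eq_one) ((Coupling.mix V c).joint i)).le
  exact fun a b _ _ h => (Setoid.inf_iff_and.1 h).1

variable [Fintype G]

/-- Mix nearly optimal couplings of the conditioned spaces with `B`. At each `i` the joint entropy,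
counted twice in the cost, exceeds the average by at most the entropy of `V`, while the entropy of
`A` is at least its conditioned average. Summing over `i` gives the factor `2|G|`. -/
theorem edist_le_mix (A B : PartitionedSpace.{u} G) {T : Type u} [Fintype T]
    (V : A.carrier → T) :
    edist A B ≤ 2 * Fintype.card G * ∑ t, Real.negMulLog (fiberWeight A.weight V t) +
      ∑ t, fiberWeight A.weight V t * edist (A.cond V t) B := by
  refine le_of_forall_pos_le_add fun ε hε => ?_
  choose c hc using fun t => exists_cost_lt (A.cond V t) B hε
  have hp1 : ∑ t, fiberWeight A.weight V t = 1 := by rw [sum_fiberWeight, A.sum_eq_one]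
  have h1 : ∑ t, fiberWeight A.weight V t * (c t).cost ≤
      ∑ t, fiberWeight A.weight V t * edist (A.cond V t) B + ε := by
    calc _ ≤ ∑ t, (fiberWeight A.weight V t * edist (A.cond V t) B +
          fiberWeight A.weight V t * ε) := Finset.sum_le_sum fun t _ => by
            rw [← mul_add]
            exact mul_le_mul_of_nonneg_left (hc t).le (fiberWeight_nonneg A.nonneg V t)
      _ = _ := by rw [Finset.sum_add_distrib, ← Finset.sum_mul, hp1, one_mul]
  have h2 : (Coupling.mix V c).cost ≤
      2 * Fintype.card G * ∑ t, Real.negMulLog (fiberWeight A.weight V t) +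
        ∑ t, fiberWeight A.weight V t * (c t).cost := by
    have h3 : ∀ i, 2 * (Coupling.mix V c).jointEntropy i - A.entropy i - B.entropy i ≤
        2 * ∑ t, Real.negMulLog (fiberWeight A.weight V t) +
        ∑ t, fiberWeight A.weight V t *
          (2 * (c t).jointEntropy i - (A.cond V t).entropy i - B.entropy i) := by
      intro i
      have ha := Coupling.jointEntropy_mix_le V c i
      have hb : ∑ t, fiberWeight A.weight V t * (A.cond V t).entropy i ≤ A.entropy i :=
        sum_fiberWeight_mul_partitionEntropy_le A.nonneg A.sum_eq_one V (A.partition i)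
      have he : ∑ t, fiberWeight A.weight V t *
          (2 * (c t).jointEntropy i - (A.cond V t).entropy i - B.entropy i) =
          2 * ∑ t, fiberWeight A.weight V t * (c t).jointEntropy i -
          ∑ t, fiberWeight A.weight V t * (A.cond V t).entropy i - B.entropy i := by
        have hB : B.entropy i = ∑ t, fiberWeight A.weight V t * B.entropy i := by
          rw [← Finset.sum_mul, hp1, one_mul]
        conv_rhs => rw [hB]
        rw [Finset.mul_sum, ← Finset.sum_sub_distrib, ← Finset.sum_sub_distrib]
        refine Finset.sum_congr rfl fun t _ => ?_
        ring
      rw [he]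
      linarith
    refine (Finset.sum_le_sum fun i _ => h3 i).trans_eq ?_
    rw [Finset.sum_add_distrib, Finset.sum_const, Finset.sum_comm, Finset.card_univ, nsmul_eq_mul]
    simp only [← Finset.mul_sum, Coupling.cost]
    ring
  linarith [edist_le A B (Coupling.mix V c)]

theorem edist_tensor_cond (A D : PartitionedSpace.{u} G) {T : Type*} (V : A.carrier → T) (t : T)
    (ht : fiberWeight A.weight V t ≠ 0) :
    edist ((A.tensor D).cond (fun z : A.carrier × D.carrier => V z.1) t)
      ((A.cond V t).tensor D) = 0 := by
  classical
  have hf : fiberWeight (A.tensor D).weight (fun z : A.carrier × D.carrier => V z.1) t =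
      fiberWeight A.weight V t :=
    fiberWeight_comp (Coupling.isPushforward_prodFst D.sum_eq_one) V t
  have hw : ∀ z : A.carrier × D.carrier,
      condWeight (A.tensor D).weight (fun z : A.carrier × D.carrier => V z.1) t z =
        condWeight A.weight V t z.1 * D.weight z.2 := by
    intro z
    refine condWeight_eq_of_mul_eq (A.tensor D).nonneg (hf ▸ ht) ?_
    rw [hf, ← mul_assoc, fiberWeight_mul_condWeight A.nonneg, ite_mul, zero_mul]
    intro _
    congr
  refine edist_eq_zero_of_map (fun z : A.carrier × D.carrier => z) ?_ fun _ _ _ _ _ => Iff.rfl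
  have : ((A.tensor D).cond (fun z : A.carrier × D.carrier => V z.1) t).weight =
    ((A.cond V t).tensor D).weight := funext hw
  rw [this]
  exact .id _

end PartitionedSpace

/-! ### The metric commutative monoid of classes -/

/-- Partitioned spaces up to distance zero. -/
def EntropyClass (G : Type v) [Fintype G] : Type (max v (u + 1)) :=
  Quotient (α := PartitionedSpace.{u} G)
    { r := fun A B => A.edist B = 0
      iseqv :=
        ⟨fun A => A.edist_self, fun {A B} h => A.edist_comm B ▸ h, fun {A B C} h h' =>
          le_antisymm ((A.edist_triangle B C).trans (by rw [h, h', add_zero]))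
            (A.edist_nonneg C)⟩ }

namespace EntropyClass

variable {G : Type v} [Fintype G]

/-- The class of a partitioned space. -/
def mk (A : PartitionedSpace.{u} G) : EntropyClass.{u} G := Quotient.mk _ A

theorem mk_eq {A B : PartitionedSpace.{u} G} (h : A.edist B = 0) : mk A = mk B :=
  Quotient.sound h

theorem ind {P : EntropyClass.{u} G → Prop} (h : ∀ A, P (mk A)) (a : EntropyClass.{u} G) : P a :=
  Quotient.ind h a

noncomputable instance : Add (EntropyClass.{u} G) :=
  ⟨Quotient.map₂ PartitionedSpace.tensor fun A A' h B B' h' =>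
    le_antisymm ((PartitionedSpace.edist_tensor_le A A' B B').trans
      (by rw [show A.edist A' = 0 from h, show B.edist B' = 0 from h', add_zero]))
      (PartitionedSpace.edist_nonneg _ _)⟩

instance : Zero (EntropyClass.{u} G) := ⟨mk (PartitionedSpace.one G)⟩

theorem mk_add (A B : PartitionedSpace.{u} G) : mk A + mk B = mk (A.tensor B) := rfl

theorem add_comm' (a b : EntropyClass.{u} G) : a + b = b + a := by
  induction a using ind with | h A =>
  induction b using ind with | h B =>
  exact mk_eq (PartitionedSpace.edist_tensor_comm A B)

theorem add_zero' (a : EntropyClass.{u} G) : a + 0 = a := by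
  induction a using ind with | h A =>
  exact mk_eq (PartitionedSpace.edist_tensor_one A)

noncomputable instance : AddCommMonoid (EntropyClass.{u} G) where
  add_assoc a b c := by
    induction a using ind with | h A =>
    induction b using ind with | h B =>
    induction c using ind with | h C =>
    exact mk_eq (PartitionedSpace.edist_tensor_assoc A B C)
  add_zero := add_zero'
  zero_add a := by rw [add_comm', add_zero']
  add_comm := add_comm'
  nsmul := nsmulRec

/-- The entropy distance of classes. -/
noncomputable instance : Dist (EntropyClass.{u} G) :=
  ⟨Quotient.lift₂ PartitionedSpace.edist fun A B A' B' h h' => by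
    have h : A.edist A' = 0 := h
    have h' : B.edist B' = 0 := h'
    have h1 := A.edist_triangle A' B
    have h2 := A'.edist_triangle B' B
    have h3 := A'.edist_triangle A B'
    have h4 := A.edist_triangle B B'
    rw [B'.edist_comm B] at h2
    rw [A'.edist_comm A] at h3
    linarith⟩

theorem dist_mk (A B : PartitionedSpace.{u} G) : dist (mk A) (mk B) = A.edist B := rfl

noncomputable instance : MetricSpace (EntropyClass.{u} G) where
  dist_self a := by
    induction a using ind with | h A =>
    exact A.edist_self
  dist_comm a b := by
    induction a using ind with | h A =>
    induction b using ind with | h B =>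
    exact A.edist_comm B
  dist_triangle a b c := by
    induction a using ind with | h A =>
    induction b using ind with | h B =>
    induction c using ind with | h C =>
    exact A.edist_triangle B C
  eq_of_dist_eq_zero {a b} h := by
    induction a using ind with | h A =>
    induction b using ind with | h B =>
    exact mk_eq h

theorem dist_add_add_le (a b a' b' : EntropyClass.{u} G) :
    dist (a + b) (a' + b') ≤ dist a a' + dist b b' := by
  induction a using ind with | h A =>
  induction b using ind with | h B =>
  induction a' using ind with | h A' =>
  induction b' using ind with | h B' =>
  exact PartitionedSpace.edist_tensor_le A A' B B'

theorem dist_sum_sum_le {T : Type*} (s : Finset T) (f g : T → EntropyClass.{u} G) :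
    dist (∑ t ∈ s, f t) (∑ t ∈ s, g t) ≤ ∑ t ∈ s, dist (f t) (g t) := by
  classical
  induction s using Finset.induction_on with
  | empty => simp
  | insert t s ht ih =>
    rw [Finset.sum_insert ht, Finset.sum_insert ht, Finset.sum_insert ht]
    exact (dist_add_add_le _ _ _ _).trans (by gcongr)

theorem dist_nsmul_nsmul_le (n : ℕ) (a b : EntropyClass.{u} G) :
    dist (n • a) (n • b) ≤ n * dist a b := by
  induction n with
  | zero => simp
  | succ n ih =>
    rw [succ_nsmul, succ_nsmul]
    refine (dist_add_add_le _ _ _ _).trans ?_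
    push_cast
    linarith

theorem dist_nsmul_le (n m : ℕ) (a : EntropyClass.{u} G) :
    dist (n • a) (m • a) ≤ |(n : ℝ) - m| * dist a 0 := by
  have key : ∀ n k : ℕ, dist ((n + k) • a) (n • a) ≤ k * dist a 0 := by
    intro n k
    calc dist ((n + k) • a) (n • a) = dist (n • a + k • a) (n • a + k • 0) := by
          rw [add_nsmul, nsmul_zero, add_zero]
      _ ≤ dist (n • a) (n • a) + dist (k • a) (k • 0) := dist_add_add_le _ _ _ _
      _ ≤ k * dist a 0 := by
          rw [dist_self, zero_add]
          exact dist_nsmul_nsmul_le k a 0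
  rcases le_total m n with h | h
  · obtain ⟨k, rfl⟩ := Nat.exists_eq_add_of_le h
    simpa using key m k
  · obtain ⟨k, rfl⟩ := Nat.exists_eq_add_of_le h
    rw [dist_comm]
    simpa using key n k

/-- The mixture inequality with a spectator `c`, on which `V` does not depend; it allows the
summands of a power to be replaced one at a time. -/
theorem dist_add_le_mix (A : PartitionedSpace.{u} G) {T : Type u} [Fintype T]
    (V : A.carrier → T) (b c : EntropyClass.{u} G) :
    dist (mk A + c) b ≤ 2 * Fintype.card G * ∑ t, Real.negMulLog (fiberWeight A.weight V t) +
      ∑ t, fiberWeight A.weight V t * dist (mk (A.cond V t) + c) b := by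
  induction c using ind with | h C =>
  induction b using ind with | h B =>
  have h := PartitionedSpace.edist_le_mix (A.tensor C) B
    (fun z : A.carrier × C.carrier => V z.1)
  have hf : ∀ t, fiberWeight (A.tensor C).weight (fun z : A.carrier × C.carrier => V z.1) t =
      fiberWeight A.weight V t := fun t =>
    fiberWeight_comp (PartitionedSpace.Coupling.isPushforward_prodFst C.sum_eq_one) V t
  have hc : ∀ t, fiberWeight (A.tensor C).weight (fun z : A.carrier × C.carrier => V z.1) t *
      PartitionedSpace.edist ((A.tensor C).cond (fun z : A.carrier × C.carrier => V z.1) t) B =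
      fiberWeight A.weight V t * dist (mk (A.cond V t) + mk C) (mk B) := by
    intro t
    rw [hf]
    by_cases ht : fiberWeight A.weight V t = 0
    · simp [ht]
    · rw [← dist_mk, mk_eq (PartitionedSpace.edist_tensor_cond A C V t ht)]
      rfl
  refine le_trans h (le_of_eq ?_)
  exact congrArg₂ (· + ·) (congrArg _ (Finset.sum_congr rfl fun t _ => by rw [hf]))
    (Finset.sum_congr rfl fun t _ => hc t)

/-- Each copy of `a` is exchanged, at price `η`, for `f t` with `t` drawn according to `p`. After
`n` draws the multiplicity of `f t` is `N t` plus a binomial variable, whose mean square deviation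
from `m t` is the squared bias plus the variance `n p (1 - p)`. The free parameter `τ` turns
absolute deviations into squares; the general starting value `N` is what makes the induction work.
-/
theorem dist_nsmul_add_le {T : Type*} [Fintype T] (a : EntropyClass.{u} G)
    (f : T → EntropyClass.{u} G) (p : T → ℝ) (hp1 : ∑ t, p t = 1)
    (hp : ∀ t, 0 ≤ p t) {η : ℝ} (hmix : ∀ b c : EntropyClass.{u} G,
      dist (a + c) b ≤ η + ∑ t, p t * dist (f t + c) b) (m : T → ℕ) {τ : ℝ} (hτ : 0 < τ)
    (n : ℕ) (N : T → ℕ) :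
    dist (n • a + ∑ t, N t • f t) (∑ t, m t • f t) ≤ n * η + ∑ t, dist (f t) 0 / 2 *
      (((N t + n * p t - m t) ^ 2 + n * (p t * (1 - p t))) / τ + τ) := by
  classical
  induction n generalizing N with
  | zero =>
    simp only [zero_nsmul, zero_add, CharP.cast_eq_zero, zero_mul, add_zero]
    refine (dist_sum_sum_le _ _ _).trans (Finset.sum_le_sum fun t _ => ?_)
    refine (dist_nsmul_le _ _ _).trans ?_
    rw [div_mul_eq_mul_div, mul_comm, mul_div_assoc]
    refine mul_le_mul_of_nonneg_left ?_ dist_nonneg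
    set x : ℝ := (N t : ℝ) - m t
    -- This is the inequality `2 |x| ≤ x ^ 2 / τ + τ`.
    have h1 : x ^ 2 / τ + τ - 2 * |x| = (|x| - τ) ^ 2 / τ := by
      rw [← sq_abs x]
      field_simp
      ring
    have h2 : 0 ≤ (|x| - τ) ^ 2 / τ := by positivity
    linarith
  | succ n ih =>
    have hstep : ∀ w, f w + (n • a + ∑ t, N t • f t) =
        n • a + ∑ t, (N t + if t = w then 1 else 0) • f t := by
      intro w
      simp only [add_nsmul, Finset.sum_add_distrib, ite_smul, one_nsmul, zero_nsmul]
      rw [Finset.sum_ite_eq' Finset.univ w f, if_pos (Finset.mem_univ w), ← add_assoc, add_comm]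
      abel
    rw [succ_nsmul', add_assoc]
    refine (hmix _ _).trans ?_
    simp only [hstep]
    refine (add_le_add_right (Finset.sum_le_sum fun w _ =>
      mul_le_mul_of_nonneg_left (ih _) (hp w)) _).trans (le_of_eq ?_)
    -- One draw moves the mean by `p t` and adds `p t * (1 - p t)` to the variance.
    have hquad : ∀ t, ∑ w, p w * ((((N t + if t = w then 1 else 0 : ℕ) : ℝ) + n * p t - m t) ^ 2) =
        (N t + (n + 1) * p t - m t) ^ 2 + p t * (1 - p t) := by
      intro t
      have : ∀ w, p w * ((((N t + if t = w then 1 else 0 : ℕ) : ℝ) + n * p t - m t) ^ 2) =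
          p w * (N t + n * p t - m t) ^ 2 +
            if t = w then p w * (2 * (N t + n * p t - m t) + 1) else 0 := by
        intro w
        split_ifs <;> push_cast <;> ring
      simp only [this, Finset.sum_add_distrib, Finset.sum_ite_eq, Finset.mem_univ, if_true,
        ← Finset.sum_mul, hp1]
      ring
    have hsplit : ∀ t, ∑ w, p w * (dist (f t) 0 / 2 *
        (((((N t + if t = w then 1 else 0 : ℕ) : ℝ) + n * p t - m t) ^ 2 +
          n * (p t * (1 - p t))) / τ + τ)) = dist (f t) 0 / 2 *
        (((N t + ((n + 1 : ℕ) : ℝ) * p t - m t) ^ 2 + ((n + 1 : ℕ) : ℝ) * (p t * (1 - p t))) / τ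
          + τ) := by
      intro t
      have : ∀ w, p w * (dist (f t) 0 / 2 *
        (((((N t + if t = w then 1 else 0 : ℕ) : ℝ) + n * p t - m t) ^ 2 +
          n * (p t * (1 - p t))) / τ + τ)) = dist (f t) 0 / 2 / τ *
          (p w * ((((N t + if t = w then 1 else 0 : ℕ) : ℝ) + n * p t - m t) ^ 2)) +
          p w * (dist (f t) 0 / 2 * (n * (p t * (1 - p t)) / τ + τ)) := by
        intro w
        field_simp
        ring
      simp only [this, Finset.sum_add_distrib, ← Finset.mul_sum, ← Finset.sum_mul, hp1, hquad]
      push_cast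
      field_simp
      ring
    simp only [mul_add (p _) (_ * η), Finset.sum_add_distrib, ← Finset.sum_mul, hp1]
    have : ∑ w, p w * ∑ t, dist (f t) 0 / 2 *
        (((((N t + if t = w then 1 else 0 : ℕ) : ℝ) + n * p t - m t) ^ 2 +
          n * (p t * (1 - p t))) / τ + τ) = ∑ t, dist (f t) 0 / 2 *
        (((N t + ((n + 1 : ℕ) : ℝ) * p t - m t) ^ 2 + ((n + 1 : ℕ) : ℝ) * (p t * (1 - p t))) / τ
          + τ) := by
      simp only [Finset.mul_sum]
      rw [Finset.sum_comm]
      exact Finset.sum_congr rfl fun t _ => hsplit t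
    rw [this]
    push_cast
    ring

end EntropyClass

/-! ### Finite probability spaces as weights on atoms -/

open scoped Classical in
theorem PMF.filter_fiber_apply {A B : Type*} (p : PMF A) (f : A → B) (b : B)
    (h : ∃ s ∈ {s | f s = b}, s ∈ p.support) (a : A) :
    p.filter {s | f s = b} h a = if f a = b then p a * (p.map f b)⁻¹ else 0 := by
  have h2 : ∑' a', ({s | f s = b}.indicator p) a' = p.map f b := by
    rw [PMF.map_apply]
    refine tsum_congr fun s => ?_
    simp only [Set.indicator_apply, Set.mem_ofPred_eq, eq_comm]
  rw [PMF.filter_apply, h2, Set.indicator_apply]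
  simp only [Set.mem_ofPred_eq]
  split_ifs <;> simp

namespace FinProb

theorem hom_ext {X Y : FinProb.{u}} {r s : X ⟶ Y} (h : ∀ x ∈ X.p.support, rep r x = rep s x) :
    r = s := by
  rw [← homOf_rep r, ← homOf_rep s]
  exact homOf_eq_iff.2 h

theorem weight_pos (X : FinProb.{u}) (x : X.Atom) : 0 < X.weight x :=
  ENNReal.toReal_pos ((PMF.mem_support_iff _ _).1 x.2) (PMF.apply_ne_top _ _)

open scoped Classical in
theorem toReal_map_apply (X : FinProb.{u}) {B : Type*} (f : X.carrier → B) (b : B) :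
    (X.p.map f b).toReal = ∑ a : X.Atom, if f a.1 = b then X.weight a else 0 := by
  rw [PMF.map_apply]
  have h1 : ∑' a, (if b = f a then X.p a else 0) =
      ∑ a ∈ X.finite_support.toFinset, (if b = f a then X.p a else 0) := by
    refine tsum_eq_sum fun a ha => ?_
    rw [Set.Finite.mem_toFinset, PMF.mem_support_iff, not_not] at ha
    simp [ha]
  have h2 : ∑ a ∈ X.finite_support.toFinset, (if b = f a then X.p a else 0) =
      ∑ a : X.Atom, (if b = f a.1 then X.p a.1 else 0) :=
    @Finset.sum_subtype _ _ _ _ (fintypeAtom X) _ (fun _ => Set.Finite.mem_toFinset _) _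
  rw [h1, h2, ENNReal.toReal_sum]
  · refine Finset.sum_congr rfl fun a _ => ?_
    by_cases h : f a.1 = b
    · simp [h, weight]
    · simp [h, Ne.symm h]
  · intro a _
    split_ifs
    · exact PMF.apply_ne_top _ _
    · simp

/-- The map induced on atoms. -/
def atomMap {X Y : FinProb.{u}} (f : X.carrier → Y.carrier) (hf : X.p.map f = Y.p) (x : X.Atom) :
    Y.Atom := ⟨f x.1, mem_support_of_map ⟨f, hf⟩ x.2⟩

theorem isPushforward_atomMap {X Y : FinProb.{u}} (f : X.carrier → Y.carrier)
    (hf : X.p.map f = Y.p) : IsPushforward (atomMap f hf) X.weight Y.weight := by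
  classical
  intro y
  refine Eq.trans ?_ ((X.toReal_map_apply f y.1).symm.trans
    (congrArg (fun q : PMF _ => (q y.1).toReal) hf))
  refine Finset.sum_congr rfl fun a _ => ?_
  have : atomMap f hf a = y ↔ f a.1 = y.1 := Subtype.ext_iff
  simp only [this]

theorem sum_weight (X : FinProb.{u}) : ∑ a, X.weight a = 1 := by
  classical
  have := X.toReal_map_apply (Function.const _ PUnit.unit.{1}) PUnit.unit
  rw [PMF.map_const] at this
  simpa using this.symm

theorem entropy_eq_partitionEntropy {X Y : FinProb.{u}} (f : X.carrier → Y.carrier)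
    (hf : X.p.map f = Y.p) :
    Y.entropy = partitionEntropy X.weight (Setoid.ker fun a : X.Atom => f a.1) := by
  have h1 := partitionEntropy_ker (isPushforward_atomMap f hf)
  have h2 : Setoid.ker (atomMap f hf) = Setoid.ker fun a : X.Atom => f a.1 := by
    ext a b
    exact Subtype.ext_iff
  rw [← h2, h1, entropy]

theorem isPushforward_val (X : FinProb.{u}) :
    IsPushforward (fun a : X.Atom => a.1) X.weight fun a => (X.p a).toReal := by
  classical
  intro a
  rw [← toReal_map_apply X (fun a => a)]
  exact congrArg (fun q : PMF _ => (q a).toReal) (PMF.map_id X.p)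

end FinProb

/-! ### Diagrams as partitioned initial spaces, fans as couplings -/

namespace ProbDiagram

variable {G : Type v} [SemilatticeInf G] [Fintype G]

theorem rep_fromInitial (X : ProbDiagram.{u} G) (ι : G) {i j : G} (h : i ⟶ j)
    {x : (X.obj (initialObj ι)).carrier} (hx : x ∈ (X.obj (initialObj ι)).p.support) :
    FinProb.rep (X.map h) (fromInitial X ι i x) = fromInitial X ι j x := by
  have := FinProb.rep_comp (X.map (homOfLE (initialObj_le ι i))) (X.map h) hx
  rw [← X.map_comp] at this
  exact this.symm

theorem map_fromInitial (X : ProbDiagram.{u} G) (ι i : G) :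
    (X.obj (initialObj ι)).p.map (fromInitial X ι i) = (X.obj i).p :=
  FinProb.map_rep _

theorem fromInitial_self (X : ProbDiagram.{u} G) (ι : G)
    {x : (X.obj (initialObj ι)).carrier} (hx : x ∈ (X.obj (initialObj ι)).p.support) :
    fromInitial X ι (initialObj ι) x = x := by
  have : X.map (homOfLE (initialObj_le ι (initialObj ι))) = 𝟙 _ := X.map_id _
  rw [fromInitial, this]
  exact FinProb.rep_id hx

theorem rep_app_fromInitial {Z X : ProbDiagram.{u} G} (f : Z ⟶ X) (ι i : G)
    {z : (Z.obj (initialObj ι)).carrier} (hz : z ∈ (Z.obj (initialObj ι)).p.support) :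
    fromInitial X ι i (FinProb.rep (f.app (initialObj ι)) z) =
      FinProb.rep (f.app i) (fromInitial Z ι i z) := by
  have h1 := FinProb.rep_comp (f.app (initialObj ι)) (X.map (homOfLE (initialObj_le ι i))) hz
  have h2 := FinProb.rep_comp (Z.map (homOfLE (initialObj_le ι i))) (f.app i) hz
  rw [f.naturality] at h2
  exact h1.symm.trans h2

/-- The atoms of the initial space, partitioned by the maps to the spaces of the diagram. -/
noncomputable abbrev toPartitioned (ι : G) (X : ProbDiagram.{u} G) : PartitionedSpace.{u} G where
  carrier := (X.obj (initialObj ι)).Atom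
  weight := (X.obj (initialObj ι)).weight
  nonneg a := (FinProb.weight_pos _ a).le
  sum_eq_one := FinProb.sum_weight _
  partition i := Setoid.ker fun a : (X.obj (initialObj ι)).Atom => fromInitial X ι i a.1

theorem entropy_toPartitioned (ι : G) (X : ProbDiagram.{u} G) (i : G) :
    (X.toPartitioned ι).entropy i = (X.obj i).entropy :=
  (FinProb.entropy_eq_partitionEntropy _ (map_fromInitial X ι i)).symm

section Fan

variable {X Y : ProbDiagram.{u} G} {ι : G}

/-- The coupling induced by a fan. -/
noncomputable def couplingOfFan (ι : G) {Z : ProbDiagram.{u} G} (f : Z ⟶ X) (g : Z ⟶ Y) :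
    PartitionedSpace.Coupling (X.toPartitioned ι) (Y.toPartitioned ι) where
  carrier := (Z.obj (initialObj ι)).Atom
  weight := (Z.obj (initialObj ι)).weight
  nonneg a := (FinProb.weight_pos _ a).le
  fst := FinProb.atomMap (FinProb.rep (f.app _)) (FinProb.map_rep _)
  snd := FinProb.atomMap (FinProb.rep (g.app _)) (FinProb.map_rep _)
  pushforward_fst := FinProb.isPushforward_atomMap _ _
  pushforward_snd := FinProb.isPushforward_atomMap _ _

/-- By naturality, initial points with the same image in `Z` at `i` have the same images in `X` and
`Y` at `i`. -/
theorem jointEntropy_couplingOfFan_le {Z : ProbDiagram.{u} G} (f : Z ⟶ X) (g : Z ⟶ Y) (i : G) :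
    (couplingOfFan ι f g).jointEntropy i ≤ (Z.obj i).entropy := by
  rw [← entropy_toPartitioned ι Z i]
  refine partitionEntropy_mono (couplingOfFan ι f g).nonneg fun a b _ _ h => ?_
  have h : fromInitial Z ι i a.1 = fromInitial Z ι i b.1 := h
  refine ((couplingOfFan ι f g).joint_rel i a b).2 ⟨?_, ?_⟩
  · change fromInitial X ι i (FinProb.rep (f.app (initialObj ι)) a.1) =
      fromInitial X ι i (FinProb.rep (f.app (initialObj ι)) b.1)
    rw [rep_app_fromInitial f ι i a.2, rep_app_fromInitial f ι i b.2, h]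
  · change fromInitial Y ι i (FinProb.rep (g.app (initialObj ι)) a.1) =
      fromInitial Y ι i (FinProb.rep (g.app (initialObj ι)) b.1)
    rw [rep_app_fromInitial g ι i a.2, rep_app_fromInitial g ι i b.2, h]

variable (c : PartitionedSpace.Coupling (X.toPartitioned ι) (Y.toPartitioned ι))

/-- The finite probability space underlying a coupling. -/
noncomputable abbrev couplingSpace : FinProb.{u} where
  carrier := c.carrier
  p := PMF.ofFintype (fun a => ENNReal.ofReal (c.weight a)) (by
    rw [← ENNReal.ofReal_sum_of_nonneg fun a _ => c.nonneg a, c.sum_eq_one, ENNReal.ofReal_one])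
  finite_support := Set.toFinite _

theorem isPushforward_couplingSpace :
    IsPushforward (fun a : (couplingSpace c).Atom => a.1) (couplingSpace c).weight c.weight := by
  have h : (fun a => ((couplingSpace c).p a).toReal) = c.weight :=
    funext fun a => ENNReal.toReal_ofReal (c.nonneg a)
  exact h ▸ (couplingSpace c).isPushforward_val

theorem map_couplingSpace {Q : FinProb.{u}} (f : c.carrier → Q.Atom)
    (hf : IsPushforward f c.weight Q.weight) :
    (couplingSpace c).p.map (fun a => (f a).1) = Q.p := by
  classical
  ext b
  rw [← ENNReal.toReal_eq_toReal_iff' (PMF.apply_ne_top _ _) (PMF.apply_ne_top _ _)]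
  refine (FinProb.toReal_map_apply (couplingSpace c) (fun a => (f a).1) b).trans ?_
  have h := (isPushforward_couplingSpace c).sum_mul fun a => if (f a).1 = b then 1 else 0
  simp only [mul_ite, mul_one, mul_zero] at h
  refine h.trans ?_
  by_cases hb : b ∈ Q.p.support
  · refine Eq.trans ?_ (hf ⟨b, hb⟩)
    exact Finset.sum_congr rfl fun a _ =>
      if_congr (Subtype.ext_iff (a1 := f a) (a2 := ⟨b, hb⟩)).symm rfl rfl
  · rw [PMF.mem_support_iff, not_not] at hb
    rw [hb, ENNReal.toReal_zero]
    refine Finset.sum_eq_zero fun a _ => if_neg fun h => ?_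
    exact (PMF.mem_support_iff _ _).1 (f a).2 (h ▸ hb)

/-- The map from a coupling to the product of the spaces at `i`. -/
noncomputable def couplingMap (i : G) (a : c.carrier) : (X.obj i).carrier × (Y.obj i).carrier :=
  (fromInitial X ι i (c.fst a).1, fromInitial Y ι i (c.snd a).1)

theorem prodMap_couplingMap {i j : G} (h : i ⟶ j) (a : c.carrier) :
    Prod.map (FinProb.rep (X.map h)) (FinProb.rep (Y.map h)) (couplingMap c i a) =
      couplingMap c j a :=
  Prod.ext (rep_fromInitial X ι h (c.fst a).2) (rep_fromInitial Y ι h (c.snd a).2)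

/-- The space at `i` of the diagram of a coupling. -/
noncomputable abbrev couplingObj (i : G) : FinProb.{u} where
  carrier := (X.obj i).carrier × (Y.obj i).carrier
  p := (couplingSpace c).p.map (couplingMap c i)
  finite_support := by
    rw [PMF.support_map]
    exact (couplingSpace c).finite_support.image _

theorem exists_of_mem_support_couplingObj {i : G} {z : (X.obj i).carrier × (Y.obj i).carrier}
    (hz : z ∈ (couplingObj c i).p.support) : ∃ a : c.carrier, couplingMap c i a = z := by
  simp only [couplingObj] at hz
  rw [PMF.support_map] at hz
  obtain ⟨a, _, ha⟩ := hz
  exact ⟨a, ha⟩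

theorem map_couplingObj {i j : G} (h : i ⟶ j) : (couplingObj c i).p.map
    (Prod.map (FinProb.rep (X.map h)) (FinProb.rep (Y.map h))) = (couplingObj c j).p := by
  rw [PMF.map_comp]
  exact congrArg (fun f => PMF.map f (couplingSpace c).p)
    (funext fun a => prodMap_couplingMap c h a)

/-- The diagram of a coupling. -/
noncomputable abbrev couplingDiagram : ProbDiagram.{u} G where
  obj := couplingObj c
  map {i j} h := FinProb.homOf (X := couplingObj c i) (Y := couplingObj c j)
    (Prod.map (FinProb.rep (X.map h)) (FinProb.rep (Y.map h))) (map_couplingObj c h)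
  map_id i := by
    refine FinProb.homOf_eq_iff.2 fun z hz => ?_
    obtain ⟨a, rfl⟩ := exists_of_mem_support_couplingObj c hz
    exact prodMap_couplingMap c (𝟙 i) a
  map_comp {i j k} h h' := by
    refine FinProb.homOf_eq_iff.2 fun z hz => ?_
    obtain ⟨a, rfl⟩ := exists_of_mem_support_couplingObj c hz
    refine (prodMap_couplingMap c (h ≫ h') a).trans (Eq.symm ?_)
    exact (congrArg _ (prodMap_couplingMap c h a)).trans (prodMap_couplingMap c h' a)

theorem map_fst_couplingObj (i : G) : (couplingObj c i).p.map Prod.fst = (X.obj i).p := by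
  rw [PMF.map_comp, ← map_fromInitial X ι i, ← map_couplingSpace c c.fst c.pushforward_fst,
    PMF.map_comp]
  rfl

theorem map_snd_couplingObj (i : G) : (couplingObj c i).p.map Prod.snd = (Y.obj i).p := by
  rw [PMF.map_comp, ← map_fromInitial Y ι i, ← map_couplingSpace c c.snd c.pushforward_snd,
    PMF.map_comp]
  rfl

/-- The first reduction of the fan of a coupling. -/
noncomputable def couplingFst : couplingDiagram c ⟶ X where
  app i := FinProb.homOf (X := couplingObj c i) Prod.fst (map_fst_couplingObj c i)
  naturality {i j} h := by
    refine FinProb.hom_ext fun z hz => ?_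
    have hz' := FinProb.rep_mem_support ((couplingDiagram c).map h) hz
    rw [FinProb.rep_comp _ _ hz, FinProb.rep_comp _ _ hz]
    erw [FinProb.rep_homOf _ _ hz', FinProb.rep_homOf _ _ hz, FinProb.rep_homOf _ _ hz]
    rfl

/-- The second reduction of the fan of a coupling. -/
noncomputable def couplingSnd : couplingDiagram c ⟶ Y where
  app i := FinProb.homOf (X := couplingObj c i) Prod.snd (map_snd_couplingObj c i)
  naturality {i j} h := by
    refine FinProb.hom_ext fun z hz => ?_
    have hz' := FinProb.rep_mem_support ((couplingDiagram c).map h) hz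
    rw [FinProb.rep_comp _ _ hz, FinProb.rep_comp _ _ hz]
    erw [FinProb.rep_homOf _ _ hz', FinProb.rep_homOf _ _ hz, FinProb.rep_homOf _ _ hz]
    rfl

theorem entropy_couplingObj (i : G) : (couplingObj c i).entropy = c.jointEntropy i := by
  rw [FinProb.entropy_eq_partitionEntropy (X := couplingSpace c) (couplingMap c i) rfl,
    PartitionedSpace.Coupling.jointEntropy, ← partitionEntropy_comap (isPushforward_couplingSpace c)]
  refine congrArg _ (Setoid.ext fun a b => ?_)
  refine Iff.trans ?_ (c.joint_rel i a.1 b.1).symm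
  exact Prod.ext_iff

/-- The space of the fan at `i` carries exactly the joint partition. Its entropy dominates both
marginal entropies, so the absolute values drop out. -/
theorem entropyDist_coupling :
    entropyDist (couplingFst c) (couplingSnd c) = c.cost := by
  rw [entropyDist, PartitionedSpace.Coupling.cost, ← Finset.sum_add_distrib]
  refine Finset.sum_congr rfl fun i _ => ?_
  have h1 := c.fst_le_jointEntropy i
  have h2 := c.snd_le_jointEntropy i
  have h3 : ((couplingDiagram c).obj i).entropy = c.jointEntropy i := entropy_couplingObj c i
  rw [entropy_toPartitioned] at h1 h2
  rw [h3, abs_of_nonneg (by linarith), abs_of_nonneg (by linarith), entropy_toPartitioned,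
    entropy_toPartitioned]
  ring

end Fan

/-- A coupling of the initial spaces yields a fan of equal cost, and a fan yields a coupling of no
larger cost. Here `ι` serves only to show that `G` has an initial object. -/
theorem intrinsicDist_eq_edist (ι : G) (X Y : ProbDiagram.{u} G) :
    intrinsicDist X Y = (X.toPartitioned ι).edist (Y.toPartitioned ι) := by
  apply le_antisymm
  · refine le_ciInf fun c => csInf_le ⟨0, ?_⟩ ?_
    · rintro _ ⟨Z, f, g, rfl⟩
      exact add_nonneg (Finset.sum_nonneg fun _ _ => abs_nonneg _)
        (Finset.sum_nonneg fun _ _ => abs_nonneg _)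
    · exact ⟨_, couplingFst c, couplingSnd c, (entropyDist_coupling c).symm⟩
  · refine le_csInf ?_ ?_
    · let c := PartitionedSpace.Coupling.indep (X.toPartitioned ι) (Y.toPartitioned ι)
      exact ⟨_, _, couplingFst c, couplingSnd c, rfl⟩
    · rintro _ ⟨Z, f, g, rfl⟩
      refine (PartitionedSpace.edist_le _ _ (couplingOfFan ι f g)).trans ?_
      rw [entropyDist, PartitionedSpace.Coupling.cost, ← Finset.sum_add_distrib]
      refine Finset.sum_le_sum fun i _ => ?_
      have h := jointEntropy_couplingOfFan_le (ι := ι) f g i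
      rw [entropy_toPartitioned, entropy_toPartitioned]
      have h1 := le_abs_self ((Z.obj i).entropy - (X.obj i).entropy)
      have h2 := le_abs_self ((Z.obj i).entropy - (Y.obj i).entropy)
      linarith

/-- The class of a diagram. -/
noncomputable def toClass (ι : G) (X : ProbDiagram.{u} G) : EntropyClass.{u} G :=
  EntropyClass.mk (X.toPartitioned ι)

theorem intrinsicDist_eq_dist (ι : G) (X Y : ProbDiagram.{u} G) :
    intrinsicDist X Y = dist (X.toClass ι) (Y.toClass ι) :=
  intrinsicDist_eq_edist ι X Y

theorem toClass_tensor (ι : G) (X Y : ProbDiagram.{u} G) :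
    (X.tensor Y).toClass ι = X.toClass ι + Y.toClass ι := by
  classical
  rw [toClass, toClass, toClass, EntropyClass.mk_add]
  let h : ((X.tensor Y).obj (initialObj ι)).Atom →
      (X.obj (initialObj ι)).Atom × (Y.obj (initialObj ι)).Atom := fun a =>
    (⟨a.1.1, (FinProb.mem_support_tensor a.2).1⟩, ⟨a.1.2, (FinProb.mem_support_tensor a.2).2⟩)
  refine EntropyClass.mk_eq (PartitionedSpace.edist_eq_zero_of_map h ?_ ?_)
  · rintro ⟨x, y⟩
    have h1 := (FinProb.isPushforward_val ((X.tensor Y).obj (initialObj ι))) (x.1, y.1)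
    have h2 : (((X.tensor Y).obj (initialObj ι)).p (x.1, y.1)) =
        (X.obj (initialObj ι)).p x.1 * (Y.obj (initialObj ι)).p y.1 := by
      change ((X.obj (initialObj ι)).p.bind fun x =>
        (Y.obj (initialObj ι)).p.map fun y => (x, y)) (x.1, y.1) = _
      rw [PMF.bind_apply, tsum_eq_single x.1]
      · rw [PMF.map_apply, tsum_eq_single y.1]
        · simp
        · intro b hb
          simp [Ne.symm hb]
      · intro b hb
        rw [PMF.map_apply]
        simp [Ne.symm hb]
    replace h1 := h1.trans ((congrArg ENNReal.toReal h2).trans ENNReal.toReal_mul)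
    refine Eq.trans (Finset.sum_congr rfl fun a _ => ?_) h1
    have : h a = (x, y) ↔ a.1 = (x.1, y.1) := by
      exact ⟨fun e => Prod.ext (congrArg (fun z => z.1.1) e) (congrArg (fun z => z.2.1) e),
        fun e => Prod.ext (Subtype.ext (congrArg Prod.fst e)) (Subtype.ext (congrArg Prod.snd e))⟩
    exact if_congr this rfl rfl
  · intro i a a' _ _
    have key : ∀ a : ((X.tensor Y).obj (initialObj ι)).Atom,
        fromInitial (X.tensor Y) ι i a.1 = (fromInitial X ι i a.1.1, fromInitial Y ι i a.1.2) :=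
      fun a => FinProb.rep_homOf _ _ a.2
    change fromInitial (X.tensor Y) ι i a.1 = fromInitial (X.tensor Y) ι i a'.1 ↔ _
    exact (Eq.congr (key a) (key a')).trans Prod.ext_iff

theorem toClass_one (ι : G) : (one.{u} G).toClass ι = 0 := by
  refine EntropyClass.mk_eq (PartitionedSpace.edist_eq_zero_of_map (fun _ => PUnit.unit) ?_ ?_)
  · intro b
    refine Eq.trans ?_ ((one.{u} G).toPartitioned ι).sum_eq_one
    exact Finset.sum_congr rfl fun a _ => if_pos rfl
  · intro i a a' _ _
    exact iff_of_true (Subsingleton.elim (α := PUnit) _ _) trivial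

theorem toClass_pow (ι : G) (X : ProbDiagram.{u} G) (n : ℕ) :
    (X.pow n).toClass ι = n • X.toClass ι := by
  induction n with
  | zero => rw [pow, toClass_one, zero_nsmul]
  | succ n ih => rw [pow, toClass_tensor, ih, succ_nsmul]

/-- The map on atoms from the initial space to the space at `ι`. -/
noncomputable def initialAtomMap (X : ProbDiagram.{u} G) (ι : G) :
    (X.toPartitioned ι).carrier → (X.obj ι).Atom :=
  FinProb.atomMap (fromInitial X ι ι) (map_fromInitial X ι ι)

theorem fiberWeight_initialAtomMap (X : ProbDiagram.{u} G) (ι : G) (x : (X.obj ι).Atom) :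
    fiberWeight (X.toPartitioned ι).weight (initialAtomMap X ι) x = (X.obj ι).weight x :=
  FinProb.isPushforward_atomMap (fromInitial X ι ι) (map_fromInitial X ι ι) x

theorem ker_initialAtomMap (X : ProbDiagram.{u} G) (ι : G) :
    Setoid.ker (initialAtomMap X ι) = (X.toPartitioned ι).partition ι := by
  ext a b
  exact Subtype.ext_iff

theorem toReal_condSpace_apply (X : ProbDiagram.{u} G) (ι : G) (x : (X.obj ι).Atom)
    (a : (X.toPartitioned ι).carrier) :
    ((condSpace X ι x (initialObj ι)).p a.1).toReal =
      condWeight (X.toPartitioned ι).weight (initialAtomMap X ι) x a := by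
  classical
  have h1 : (condSpace X ι x (initialObj ι)).p = condInitial X ι x := by
    refine (FinProb.map_congr_support (condInitial X ι x) (g := id) fun s hs => ?_).trans
      (PMF.map_id _)
    exact fromInitial_self X ι (mem_support_of_cond hs)
  have h2 : condInitial X ι x a.1 = if fromInitial X ι ι a.1 = x.1 then
      (X.obj (initialObj ι)).p a.1 * ((X.obj ι).p x.1)⁻¹ else 0 :=
    (PMF.filter_fiber_apply _ _ _ _ _).trans
      (congrArg (fun q : PMF (X.obj ι).carrier => if fromInitial X ι ι a.1 = x.1 then
        (X.obj (initialObj ι)).p a.1 * (q x.1)⁻¹ else 0) (map_fromInitial X ι ι))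
  have h3 : initialAtomMap X ι a = x ↔ fromInitial X ι ι a.1 = x.1 := Subtype.ext_iff
  refine (congrArg ENNReal.toReal ((congrArg
    (fun q : PMF (X.obj (initialObj ι)).carrier => q a.1) h1).trans h2)).trans ?_
  rw [condWeight, fiberWeight_initialAtomMap, if_neg (FinProb.weight_pos _ x).ne']
  by_cases h : initialAtomMap X ι a = x
  · rw [if_pos h, if_pos (h3.1 h), ENNReal.toReal_mul, ENNReal.toReal_inv]
    rfl
  · rw [if_neg h, if_neg (h3.not.1 h), ENNReal.toReal_zero]

/-- The conditioned diagram keeps only the atoms in the fiber, while conditioning of weights keeps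
all points, those outside with weight zero. The inclusion of atoms identifies the two. -/
theorem toClass_cond (X : ProbDiagram.{u} G) (ι : G) (x : (X.obj ι).Atom) :
    (X.cond ι x).toClass ι =
      EntropyClass.mk ((X.toPartitioned ι).cond (initialAtomMap X ι) x) := by
  classical
  let h : (condSpace X ι x (initialObj ι)).Atom → (X.obj (initialObj ι)).Atom := fun a =>
    ⟨a.1, mem_support_of_condSpace a.2⟩
  refine EntropyClass.mk_eq (PartitionedSpace.edist_eq_zero_of_map h ?_ ?_)
  · intro b
    have h1 := FinProb.isPushforward_val (condSpace X ι x (initialObj ι)) b.1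
    refine Eq.trans (Finset.sum_congr rfl fun a _ => ?_)
      (h1.trans (toReal_condSpace_apply X ι x b))
    exact if_congr Subtype.ext_iff rfl rfl
  · intro i a a' _ _
    have key : ∀ a : (condSpace X ι x (initialObj ι)).Atom,
        fromInitial (X.cond ι x) ι i a.1 = fromInitial X ι i a.1 :=
      fun a => FinProb.rep_homOf _ _ a.2
    change fromInitial (X.cond ι x) ι i a.1 = fromInitial (X.cond ι x) ι i a'.1 ↔ _
    exact Eq.congr (key a) (key a')

end ProbDiagram

theorem Tropical.toClass_condSeq {G : Type v} [SemilatticeInf G] [Fintype G]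
    (X : ProbDiagram.{u} G) (ι : G) (n : ℕ) :
    (condSeq X ι n).toClass ι = ∑ x, ⌊(n : ℝ) * (X.obj ι).weight x⌋₊ •
      EntropyClass.mk ((X.toPartitioned ι).cond (ProbDiagram.initialAtomMap X ι) x) := by
  have key : ∀ l : List (X.obj ι).Atom, ((l.map fun x =>
      smulSeq ((X.obj ι).weight x) (linearSeq (X.cond ι x))).foldr addSeq (zeroSeq G) n).toClass ι =
      (l.map fun x => ⌊(n : ℝ) * (X.obj ι).weight x⌋₊ • (X.cond ι x).toClass ι).sum := by
    intro l
    induction l with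
    | nil => exact ProbDiagram.toClass_one ι
    | cons x l ih =>
      rw [List.map_cons, List.map_cons, List.foldr_cons, List.sum_cons, ← ih,
        ← ProbDiagram.toClass_pow, ← ProbDiagram.toClass_tensor]
      rfl
  rw [condSeq, key, Finset.sum_map_toList]
  exact Finset.sum_congr rfl fun x _ => by rw [ProbDiagram.toClass_cond]

/-! ### Sums of conditioned spaces -/

namespace PartitionedSpace

variable {G : Type v} [Fintype G]

/-- The sum of the conditioned spaces, the one over `t` being taken `⌊n * p t⌋` times. -/
noncomputable def condSum (A : PartitionedSpace.{u} G) {T : Type*} [Fintype T]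
    (V : A.carrier → T) (n : ℕ) : EntropyClass.{u} G :=
  ∑ t, ⌊(n : ℝ) * fiberWeight A.weight V t⌋₊ • EntropyClass.mk (A.cond V t)

theorem condSum_equiv (A : PartitionedSpace.{u} G) {S T : Type*} [Fintype S] [Fintype T]
    (e : S ≃ T) (V : A.carrier → S) (n : ℕ) :
    A.condSum (fun a => e (V a)) n = A.condSum V n := by
  classical
  rw [condSum, condSum, ← e.sum_comp]
  refine Finset.sum_congr rfl fun s _ => ?_
  have h1 : fiberWeight A.weight (fun a => e (V a)) (e s) = fiberWeight A.weight V s := by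
    simp [fiberWeight]
  have h2 : A.cond (fun a => e (V a)) (e s) = A.cond V s := by
    have hw : condWeight A.weight (fun a => e (V a)) (e s) = condWeight A.weight V s := by
      funext a
      simp [condWeight, h1]
    simp only [cond, hw]
  rw [h1, h2]

theorem mk_cond_cond (A : PartitionedSpace.{u} G) {S T : Type*} (U : A.carrier → S)
    (V : A.carrier → T) (s : S) (t : T)
    (h : fiberWeight A.weight (fun a => (U a, V a)) (s, t) ≠ 0) :
    EntropyClass.mk ((A.cond U s).cond V t) =
      EntropyClass.mk (A.cond (fun a => (U a, V a)) (s, t)) := by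
  refine EntropyClass.mk_eq (edist_eq_zero_of_map (fun a : A.carrier => a) ?_
    fun _ _ _ _ _ => Iff.rfl)
  have : ((A.cond U s).cond V t).weight = (A.cond (fun a => (U a, V a)) (s, t)).weight :=
    condWeight_condWeight A.nonneg U V s t h
  rw [← this]
  exact .id _

theorem sum_negMulLog_fiberWeight_nonneg {A T : Type*} [Fintype A] [Fintype T] {μ : A → ℝ}
    (hμ : ∀ a, 0 ≤ μ a) (hμ1 : ∑ a, μ a = 1) (V : A → T) :
    0 ≤ ∑ t, Real.negMulLog (fiberWeight μ V t) := by
  rw [← partitionEntropy_ker (isPushforward_fiberWeight μ V)]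
  exact partitionEntropy_nonneg hμ hμ1 _

/-- Conditioning on a finer variable changes the sum of the conditioned spaces by at most a
multiple of the conditional entropy. -/
theorem exists_dist_condSum_le (A : PartitionedSpace.{u} G) {S T : Type u} [Fintype S]
    [Fintype T] (U : A.carrier → S) (V : A.carrier → T) {ε : ℝ} (hε : 0 < ε) :
    ∃ K : ℝ, ∀ n : ℕ, dist (A.condSum U n) (A.condSum (fun a => (U a, V a)) n) ≤
      n * (2 * Fintype.card G * (partitionEntropy A.weight (Setoid.ker V ⊓ Setoid.ker U) -
        partitionEntropy A.weight (Setoid.ker U)) + ε) + K := by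
  set p : S → ℝ := fiberWeight A.weight U with hp
  set q : S → T → ℝ := fun s => fiberWeight (A.cond U s).weight V with hq
  have hp0 : ∀ s, 0 ≤ p s := fiberWeight_nonneg A.nonneg U
  have hp1 : ∑ s, p s = 1 := (sum_fiberWeight _ _).trans A.sum_eq_one
  have hq0 : ∀ s t, 0 ≤ q s t := fun s => fiberWeight_nonneg (A.cond U s).nonneg V
  have hq1 : ∀ s, ∑ t, q s t = 1 := fun s =>
    (sum_fiberWeight _ _).trans (A.cond U s).sum_eq_one
  have hq_le : ∀ s t, q s t ≤ 1 := fun s t =>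
    hq1 s ▸ Finset.single_le_sum (f := q s) (fun t _ => hq0 s t) (Finset.mem_univ t)
  have hp_le : ∀ s, p s ≤ 1 := fun s =>
    hp1 ▸ Finset.single_le_sum (f := p) (fun t _ => hp0 t) (Finset.mem_univ s)
  have hpq : ∀ s t, fiberWeight A.weight (fun a => (U a, V a)) (s, t) = p s * q s t :=
    fun s t => fiberWeight_prod A.nonneg U V s t
  set η : S → ℝ := fun s => 2 * Fintype.card G * ∑ t, Real.negMulLog (q s t) with hη
  have hη0 : ∀ s, 0 ≤ η s := fun s => mul_nonneg (by positivity)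
    (sum_negMulLog_fiberWeight_nonneg (A.cond U s).nonneg (A.cond U s).sum_eq_one V)
  -- By the chain rule the average price per copy is `2|G|` times the conditional entropy of `V`
  -- given `U`.
  have hsum : ∑ s, p s * η s = 2 * Fintype.card G *
      (partitionEntropy A.weight (Setoid.ker V ⊓ Setoid.ker U) -
        partitionEntropy A.weight (Setoid.ker U)) := by
    rw [partitionEntropy_inf_ker A.nonneg A.sum_eq_one,
      partitionEntropy_ker (isPushforward_fiberWeight A.weight U), add_sub_cancel_left,
      Finset.mul_sum]
    refine Finset.sum_congr rfl fun s _ => ?_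
    rw [partitionEntropy_ker (isPushforward_fiberWeight _ V), hη]
    exact mul_left_comm _ _ _
  set D : ℝ := ∑ s, ∑ t, dist (EntropyClass.mk ((A.cond U s).cond V t)) 0 / 2 with hD
  have hD0 : 0 ≤ D := Finset.sum_nonneg fun s _ => Finset.sum_nonneg fun t _ =>
    div_nonneg dist_nonneg zero_le_two
  -- Large enough for the variance term, of size `n D / τ`, to be at most `n ε`; the `1` keeps `τ`
  -- positive when `D = 0`.
  set τ : ℝ := D / ε + 1 with hτ
  have hτ0 : 0 < τ := by positivity
  have hDτ : D / τ ≤ ε := by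
    rw [div_le_iff₀ hτ0, hτ, mul_add, mul_div_cancel₀ _ hε.ne']
    linarith
  refine ⟨D * (1 / τ + τ), fun n => ?_⟩
  -- Joint fibers of weight zero, where iterated and joint conditioning may differ, occur with
  -- multiplicity zero.
  have hfine : A.condSum (fun a => (U a, V a)) n = ∑ s, ∑ t, ⌊(n : ℝ) * (p s * q s t)⌋₊ •
      EntropyClass.mk ((A.cond U s).cond V t) := by
    rw [condSum, Fintype.sum_prod_type]
    refine Finset.sum_congr rfl fun s _ => Finset.sum_congr rfl fun t _ => ?_
    rw [hpq]
    by_cases h : p s * q s t = 0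
    · simp [h]
    · rw [mk_cond_cond A U V s t (by rwa [hpq])]
  have hone : ∀ s, dist (⌊(n : ℝ) * p s⌋₊ • EntropyClass.mk (A.cond U s))
      (∑ t, ⌊(n : ℝ) * (p s * q s t)⌋₊ • EntropyClass.mk ((A.cond U s).cond V t)) ≤
      n * (p s * η s) + ∑ t, dist (EntropyClass.mk ((A.cond U s).cond V t)) 0 / 2 *
        ((1 + n) / τ + τ) := by
    intro s
    have h := EntropyClass.dist_nsmul_add_le (EntropyClass.mk (A.cond U s))
      (fun t => EntropyClass.mk ((A.cond U s).cond V t)) (q s) (hq1 s) (hq0 s)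
      (fun b c => EntropyClass.dist_add_le_mix (A.cond U s) V b c)
      (fun t => ⌊(n : ℝ) * (p s * q s t)⌋₊) hτ0 ⌊(n : ℝ) * p s⌋₊ 0
    simp only [Pi.zero_apply, zero_nsmul, Finset.sum_const_zero, add_zero, Nat.cast_zero,
      zero_add] at h
    have hM := Nat.floor_le (mul_nonneg n.cast_nonneg (hp0 s) : 0 ≤ (n : ℝ) * p s)
    have hM' := Nat.lt_floor_add_one ((n : ℝ) * p s)
    set M : ℝ := (⌊(n : ℝ) * p s⌋₊ : ℝ)
    have hM0 : 0 ≤ M := Nat.cast_nonneg _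
    have hMn : M ≤ n := hM.trans (mul_le_of_le_one_right n.cast_nonneg (hp_le s))
    refine h.trans (add_le_add ?_ (Finset.sum_le_sum fun t _ => ?_))
    · exact (mul_le_mul_of_nonneg_right hM (hη0 s)).trans_eq (mul_assoc _ _ _)
    · have hm := Nat.floor_le (mul_nonneg n.cast_nonneg (mul_nonneg (hp0 s) (hq0 s t)) :
        0 ≤ (n : ℝ) * (p s * q s t))
      have hm' := Nat.lt_floor_add_one ((n : ℝ) * (p s * q s t))
      set m : ℝ := (⌊(n : ℝ) * (p s * q s t)⌋₊ : ℝ)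
      -- Each of the two roundings moves its side down by less than one from `n * p s * q s t`.
      have h1 : (M * q s t - m) ^ 2 ≤ 1 := by
        rw [sq_le_one_iff_abs_le_one, abs_le]
        have e1 : M * q s t ≤ n * p s * q s t := mul_le_mul_of_nonneg_right hM (hq0 s t)
        have e2 : (n * p s - M) * q s t ≤ 1 * 1 :=
          mul_le_mul (by linarith) (hq_le s t) (hq0 s t) zero_le_one
        constructor <;> nlinarith
      have h2 : M * (q s t * (1 - q s t)) ≤ n := by
        refine (mul_le_of_le_one_right hM0 ?_).trans hMn
        nlinarith [hq0 s t, hq_le s t]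
      gcongr
  rw [hfine, condSum]
  refine (EntropyClass.dist_sum_sum_le _ _ _).trans
    ((Finset.sum_le_sum fun s _ => hone s).trans ?_)
  rw [Finset.sum_add_distrib, ← Finset.mul_sum, hsum]
  simp only [← Finset.sum_mul]
  have : D * ((1 + n) / τ + τ) = n * (D / τ) + D * (1 / τ + τ) := by
    field_simp
    ring
  rw [← hD, this]
  have := mul_le_mul_of_nonneg_left hDτ (n.cast_nonneg : (0 : ℝ) ≤ n)
  linarith

/-- The floor of a sum exceeds the sum of the floors by `0` or `1`, so each conditioned space occurs
at most once too often. The bound does not depend on `n` and `m`. -/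
theorem dist_condSum_add_le (A : PartitionedSpace.{u} G) {T : Type*} [Fintype T]
    (V : A.carrier → T) (n m : ℕ) :
    dist (A.condSum V (n + m)) (A.condSum V n + A.condSum V m) ≤
      ∑ t, dist (EntropyClass.mk (A.cond V t)) 0 := by
  rw [condSum, condSum, condSum, ← Finset.sum_add_distrib]
  refine (EntropyClass.dist_sum_sum_le _ _ _).trans (Finset.sum_le_sum fun t _ => ?_)
  rw [← add_nsmul]
  refine (EntropyClass.dist_nsmul_le _ _ _).trans (mul_le_of_le_one_left dist_nonneg ?_)
  have hp := fiberWeight_nonneg A.nonneg V t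
  set p := fiberWeight A.weight V t
  have h1 := Nat.floor_le (mul_nonneg n.cast_nonneg hp : 0 ≤ (n : ℝ) * p)
  have h2 := Nat.floor_le (mul_nonneg m.cast_nonneg hp : 0 ≤ (m : ℝ) * p)
  have h4 := Nat.lt_floor_add_one ((n : ℝ) * p)
  have h5 := Nat.lt_floor_add_one ((m : ℝ) * p)
  have h3 : ⌊(n : ℝ) * p⌋₊ + ⌊(m : ℝ) * p⌋₊ ≤ ⌊((n + m : ℕ) : ℝ) * p⌋₊ := by
    refine Nat.le_floor ?_
    push_cast
    linarith
  have h6 : ⌊((n + m : ℕ) : ℝ) * p⌋₊ < ⌊(n : ℝ) * p⌋₊ + ⌊(m : ℝ) * p⌋₊ + 2 := by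
    refine (Nat.floor_lt (by positivity)).2 ?_
    push_cast
    linarith
  have h7 : ⌊((n + m : ℕ) : ℝ) * p⌋₊ ≤ ⌊(n : ℝ) * p⌋₊ + ⌊(m : ℝ) * p⌋₊ + 1 := by omega
  rw [abs_le]
  constructor
  · linarith [show ((⌊(n : ℝ) * p⌋₊ + ⌊(m : ℝ) * p⌋₊ : ℕ) : ℝ) ≤ ⌊((n + m : ℕ) : ℝ) * p⌋₊ from
      Nat.cast_le.2 h3]
  · have : (⌊((n + m : ℕ) : ℝ) * p⌋₊ : ℝ) ≤
        ((⌊(n : ℝ) * p⌋₊ + ⌊(m : ℝ) * p⌋₊ + 1 : ℕ) : ℝ) := Nat.cast_le.2 h7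
    push_cast at this ⊢
    linarith

namespace Coupling

variable {A B : PartitionedSpace.{u} G}

/-- The first space of a coupling, pulled back to the coupling. -/
def left (c : Coupling A B) : PartitionedSpace.{u} G where
  carrier := c.carrier
  weight := c.weight
  nonneg := c.nonneg
  sum_eq_one := c.sum_eq_one
  partition i := (A.partition i).comap c.fst

theorem condSum_left (c : Coupling A B) {T : Type*} [Fintype T] (U : A.carrier → T) (n : ℕ) :
    c.left.condSum (fun a : c.carrier => U (c.fst a)) n = A.condSum U n := by
  refine Finset.sum_congr rfl fun t _ => ?_
  have h1 : fiberWeight c.left.weight (fun a : c.carrier => U (c.fst a)) t =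
      fiberWeight A.weight U t :=
    fiberWeight_comp c.pushforward_fst U t
  rw [h1]
  congr 1
  exact EntropyClass.mk_eq (edist_eq_zero_of_map c.fst
    (isPushforward_condWeight c.pushforward_fst U t) fun _ _ _ _ _ => Iff.rfl)

/-- The second space of a coupling, pulled back to the coupling. -/
abbrev right (c : Coupling A B) : PartitionedSpace.{u} G := c.symm.left

/-- The coupling of the pulled back spaces conditioned on a variable on the coupling. -/
noncomputable def cond (c : Coupling A B) {T : Type*} (W : c.carrier → T) (t : T) :
    Coupling (c.left.cond W t) (c.right.cond W t) where
  carrier := c.carrier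
  weight := condWeight c.weight W t
  nonneg := condWeight_nonneg c.nonneg W t
  fst a := a
  snd a := a
  pushforward_fst := .id _
  pushforward_snd := .id _

/-- Each summand of the cost is the conditional entropy of the joint partition given that of `A`,
plus the same for `B`. Conditioning further on `W` lowers both by submodularity (`key`), and the
entropy of `W` cancels with coefficients `2 - 1 - 1`. -/
theorem sum_fiberWeight_mul_cost_cond_le (c : Coupling A B) {T : Type*} [Fintype T]
    (W : c.carrier → T) :
    ∑ t, fiberWeight c.weight W t * (c.cond W t).cost ≤ c.cost := by
  simp only [cost, Finset.mul_sum]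
  rw [Finset.sum_comm]
  refine Finset.sum_le_sum fun i _ => ?_
  have hJ := partitionEntropy_inf_ker c.nonneg c.sum_eq_one W (c.joint i)
  have hA := partitionEntropy_inf_ker c.nonneg c.sum_eq_one W ((A.partition i).comap c.fst)
  have hB := partitionEntropy_inf_ker c.nonneg c.sum_eq_one W ((B.partition i).comap c.snd)
  have key : ∀ r : Setoid c.carrier, (∀ a b, c.joint i a b → r a b) →
      partitionEntropy c.weight (c.joint i ⊓ Setoid.ker W) + partitionEntropy c.weight r ≤
        partitionEntropy c.weight (c.joint i) + partitionEntropy c.weight (r ⊓ Setoid.ker W) := by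
    intro r hr
    refine le_trans (add_le_add_left (le_of_eq ?_) _) (partitionEntropy_submodular c.nonneg
      c.sum_eq_one (fun a b _ _ h => hr a b h) fun a b _ _ h => (Setoid.inf_iff_and.1 h).1)
    exact partitionEntropy_congr c.nonneg fun a b _ _ =>
      ⟨fun h => ⟨h.1, hr a b h.1, h.2⟩, fun h => ⟨h.1, h.2.2⟩⟩
  have kA := key ((A.partition i).comap c.fst) fun a b h => ((c.joint_rel i a b).1 h).1
  have kB := key ((B.partition i).comap c.snd) fun a b h => ((c.joint_rel i a b).1 h).2
  rw [c.entropy_fst] at kA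
  rw [c.entropy_snd] at kB
  have hsum : ∑ t, fiberWeight c.weight W t * (2 * (c.cond W t).jointEntropy i -
      (c.left.cond W t).entropy i - (c.right.cond W t).entropy i) =
      2 * ∑ t, fiberWeight c.weight W t * partitionEntropy (condWeight c.weight W t) (c.joint i) -
      ∑ t, fiberWeight c.weight W t *
        partitionEntropy (condWeight c.weight W t) ((A.partition i).comap c.fst) -
      ∑ t, fiberWeight c.weight W t *
        partitionEntropy (condWeight c.weight W t) ((B.partition i).comap c.snd) := by
    rw [Finset.mul_sum, ← Finset.sum_sub_distrib, ← Finset.sum_sub_distrib]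
    refine Finset.sum_congr rfl fun t _ => ?_
    change fiberWeight c.weight W t *
      (2 * partitionEntropy (condWeight c.weight W t) (c.joint i) -
      partitionEntropy (condWeight c.weight W t) ((A.partition i).comap c.fst) -
      partitionEntropy (condWeight c.weight W t) ((B.partition i).comap c.snd)) = _
    ring
  rw [hsum, jointEntropy]
  linarith

/-- Both sides carry the same weights, hence the same multiplicities, and are compared fiber by
fiber through the conditioned couplings. -/
theorem dist_condSum_left_right_le (c : Coupling A B) {T : Type*} [Fintype T]
    (W : c.carrier → T) (n : ℕ) :
    dist (c.left.condSum W n) (c.right.condSum W n) ≤ n * c.cost := by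
  refine (EntropyClass.dist_sum_sum_le _ _ _).trans ?_
  refine le_trans (Finset.sum_le_sum fun t _ => ?_)
    ((Finset.mul_sum _ _ _).symm.trans_le (mul_le_mul_of_nonneg_left
      (c.sum_fiberWeight_mul_cost_cond_le W) (n.cast_nonneg : (0 : ℝ) ≤ n)))
  refine (EntropyClass.dist_nsmul_nsmul_le _ _ _).trans ?_
  rw [← mul_assoc]
  exact mul_le_mul (Nat.floor_le (mul_nonneg n.cast_nonneg (fiberWeight_nonneg c.nonneg W t)))
    (edist_le _ _ (c.cond W t)) dist_nonneg
    (mul_nonneg n.cast_nonneg (fiberWeight_nonneg c.nonneg W t))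

/-- Pass from `U` to the pair, across the coupling, and from the pair back to `V`. The outer steps
cost `2|G|` times the two conditional entropies, whose sum is the summand of the cost at `ι`; the
middle step costs one more `c.cost`. -/
theorem exists_dist_condSum_le (c : Coupling A B) {S T : Type u} [Fintype S] [Fintype T]
    (U : A.carrier → S) (V : B.carrier → T) {ι : G} (hU : Setoid.ker U = A.partition ι)
    (hV : Setoid.ker V = B.partition ι) {ε : ℝ} (hε : 0 < ε) :
    ∃ K : ℝ, ∀ n : ℕ, dist (A.condSum U n) (B.condSum V n) ≤
      n * ((2 * Fintype.card G + 1) * c.cost + ε) + K := by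
  set P : c.carrier → S := fun a => U (c.fst a) with hP
  set Q : c.carrier → T := fun a => V (c.snd a) with hQ
  obtain ⟨K₁, h₁⟩ := c.left.exists_dist_condSum_le P Q (half_pos hε)
  obtain ⟨K₂, h₂⟩ := c.right.exists_dist_condSum_le Q P (half_pos hε)
  have hkerP : Setoid.ker P = (A.partition ι).comap c.fst := by rw [← hU]; rfl
  have hkerQ : Setoid.ker Q = (B.partition ι).comap c.snd := by rw [← hV]; rfl
  have eP : partitionEntropy c.weight (Setoid.ker P) = A.entropy ι := by
    rw [hkerP, c.entropy_fst]
  have eQ : partitionEntropy c.weight (Setoid.ker Q) = B.entropy ι := by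
    rw [hkerQ, c.entropy_snd]
  have ePQ : partitionEntropy c.weight (Setoid.ker P ⊓ Setoid.ker Q) = c.jointEntropy ι := by
    rw [hkerP, hkerQ]
    rfl
  have eQP : partitionEntropy c.weight (Setoid.ker Q ⊓ Setoid.ker P) = c.jointEntropy ι := by
    rw [inf_comm, ePQ]
  -- Refining `Q` by `P` produces the pair in the opposite order; relabelling the values changes
  -- nothing.
  have hswap : ∀ n, c.right.condSum (fun a : c.carrier => (Q a, P a)) n =
      c.right.condSum (fun a : c.carrier => (P a, Q a)) n := fun n =>
    c.right.condSum_equiv (Equiv.prodComm S T) (fun a : c.carrier => (P a, Q a)) n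
  have hι : 2 * c.jointEntropy ι - A.entropy ι - B.entropy ι ≤ c.cost :=
    Finset.single_le_sum (f := fun i => 2 * c.jointEntropy i - A.entropy i - B.entropy i)
      (fun i _ => by
        have := c.fst_le_jointEntropy i
        have := c.snd_le_jointEntropy i
        linarith) (Finset.mem_univ ι)
  refine ⟨K₁ + K₂, fun n => ?_⟩
  have e₁ : dist (A.condSum U n) (c.left.condSum (fun a : c.carrier => (P a, Q a)) n) ≤
      n * (2 * Fintype.card G * (c.jointEntropy ι - A.entropy ι) + ε / 2) + K₁ := by
    rw [← eQP, ← eP]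
    exact (congrArg (dist · _) (c.condSum_left U n)).symm.trans_le (h₁ n)
  have e₂ : dist (c.right.condSum (fun a : c.carrier => (P a, Q a)) n) (B.condSum V n) ≤
      n * (2 * Fintype.card G * (c.jointEntropy ι - B.entropy ι) + ε / 2) + K₂ := by
    rw [← ePQ, ← eQ, ← hswap, dist_comm]
    exact (congrArg (dist · _) (c.symm.condSum_left V n)).symm.trans_le (h₂ n)
  have e₃ := c.dist_condSum_left_right_le (fun a => (P a, Q a)) n
  have htri := dist_triangle4 (A.condSum U n) (c.left.condSum (fun a : c.carrier => (P a, Q a)) n)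
    (c.right.condSum (fun a : c.carrier => (P a, Q a)) n) (B.condSum V n)
  have hfin : (n : ℝ) * (2 * Fintype.card G *
      (2 * c.jointEntropy ι - A.entropy ι - B.entropy ι)) ≤
      n * (2 * Fintype.card G * c.cost) := by gcongr
  linarith

end Coupling

end PartitionedSpace

/-! ### Almost additive sequences -/

namespace EntropyClass

variable {G : Type v} [Fintype G]

open Filter Topology

/-- The normalized distance of two almost additive sequences converges. -/
theorem exists_tendsto_dist {a b : ℕ → EntropyClass.{u} G} {C C' : ℝ}
    (ha : ∀ n m, dist (a (n + m)) (a n + a m) ≤ C)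
    (hb : ∀ n m, dist (b (n + m)) (b n + b m) ≤ C') :
    ∃ d, Tendsto (fun n : ℕ => 1 / (n : ℝ) * dist (a n) (b n)) atTop (𝓝 d) := by
  have hC : 0 ≤ C := dist_nonneg.trans (ha 0 0)
  have hC' : 0 ≤ C' := dist_nonneg.trans (hb 0 0)
  -- The added constant absorbs both defects, so Fekete's lemma applies, and it vanishes after
  -- division by `n`.
  have hsub : Subadditive fun n => dist (a n) (b n) + (C + C') := by
    intro n m
    have h1 := dist_triangle4 (a (n + m)) (a n + a m) (b n + b m) (b (n + m))
    have h2 := dist_add_add_le (a n) (a m) (b n) (b m)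
    have h3 := hb n m
    rw [dist_comm] at h3
    linarith [ha n m]
  have hlim := hsub.tendsto_lim ⟨0, by
    rintro _ ⟨n, rfl⟩
    exact div_nonneg (add_nonneg dist_nonneg (add_nonneg hC hC')) n.cast_nonneg⟩
  have h0 : Tendsto (fun n : ℕ => (C + C') / (n : ℝ)) atTop (𝓝 0) :=
    tendsto_const_div_atTop_nhds_zero_nat _
  refine ⟨hsub.lim - 0, (hlim.sub h0).congr fun n => ?_⟩
  ring

theorem le_of_tendsto_of_le {f : ℕ → ℝ} {d x K : ℝ}
    (hf : Tendsto (fun n : ℕ => 1 / (n : ℝ) * f n) atTop (𝓝 d)) (h : ∀ n : ℕ, f n ≤ n * x + K) :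
    d ≤ x := by
  have h0 : Tendsto (fun n : ℕ => x + K / (n : ℝ)) atTop (𝓝 (x + 0)) :=
    tendsto_const_nhds.add (tendsto_const_div_atTop_nhds_zero_nat _)
  rw [add_zero] at h0
  refine le_of_tendsto_of_tendsto hf h0 ?_
  filter_upwards [eventually_gt_atTop 0] with n hn
  have hn' : (0 : ℝ) < n := Nat.cast_pos.2 hn
  rw [one_div_mul_eq_div, div_le_iff₀ hn', add_mul, div_mul_cancel₀ _ hn'.ne']
  linarith [h n]

end EntropyClass

/-! ### Tropical diagrams and their distance -/

namespace Tropical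

variable {G : Type v} [SemilatticeInf G] [Fintype G]

open Filter Topology

theorem isAsympDist_iff (ι : G) (A B : ℕ → ProbDiagram.{u} G) (d : ℝ) :
    IsAsympDist A B d ↔ Tendsto
      (fun n : ℕ => 1 / (n : ℝ) * dist ((A n).toClass ι) ((B n).toClass ι)) atTop (𝓝 d) := by
  simp only [IsAsympDist, ProbDiagram.intrinsicDist_eq_dist ι]

theorem exists_isAsympDist_linearSeq (ι : G) (X Y : ProbDiagram.{u} G) :
    ∃ d, IsAsympDist (linearSeq X) (linearSeq Y) d ∧ d ≤ dist (X.toClass ι) (Y.toClass ι) := by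
  simp only [isAsympDist_iff ι, linearSeq, ProbDiagram.toClass_pow]
  obtain ⟨d, hd⟩ := EntropyClass.exists_tendsto_dist (C := 0) (C' := 0)
    (a := fun n => n • X.toClass ι) (b := fun n => n • Y.toClass ι)
    (fun n m => by rw [add_nsmul, dist_self]) (fun n m => by rw [add_nsmul, dist_self])
  refine ⟨d, hd, EntropyClass.le_of_tendsto_of_le (K := 0) hd fun n => ?_⟩
  rw [add_zero]
  exact EntropyClass.dist_nsmul_nsmul_le n _ _

theorem toClass_condSeq_eq_condSum (X : ProbDiagram.{u} G) (ι : G) (n : ℕ) :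
    (condSeq X ι n).toClass ι =
      (X.toPartitioned ι).condSum (ProbDiagram.initialAtomMap X ι) n := by
  rw [toClass_condSeq]
  exact Finset.sum_congr rfl fun x _ => by rw [ProbDiagram.fiberWeight_initialAtomMap]

/-- The defect is bounded by a constant `K`, and `φ ≥ φ 1 > 0` on the relevant range, so `K / φ 1`
serves as the constant. -/
theorem isQuasiLinear_condSeq {φ : ℝ → ℝ} (hφ : MonotoneOn φ (Set.Ici 1)) (hφ1 : 0 < φ 1)
    (X : ProbDiagram.{u} G) (ι : G) : IsQuasiLinear φ (condSeq X ι) := by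
  set K := ∑ t, dist (EntropyClass.mk
    ((X.toPartitioned ι).cond (ProbDiagram.initialAtomMap X ι) t)) 0
  have hK : 0 ≤ K := Finset.sum_nonneg fun _ _ => dist_nonneg
  refine ⟨K / φ 1, fun n m hnm => ?_⟩
  obtain ⟨d, hd, hle⟩ := exists_isAsympDist_linearSeq ι (condSeq X ι (n + m))
    ((condSeq X ι n).tensor (condSeq X ι m))
  refine ⟨d, hd, hle.trans ?_⟩
  rw [ProbDiagram.toClass_tensor, toClass_condSeq_eq_condSum, toClass_condSeq_eq_condSum,
    toClass_condSeq_eq_condSum]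
  refine (PartitionedSpace.dist_condSum_add_le _ _ n m).trans ?_
  have h1 : (1 : ℝ) ≤ ((n + m : ℕ) : ℝ) := by exact_mod_cast hnm
  have h2 := hφ (Set.mem_Ici.2 le_rfl) (Set.mem_Ici.2 h1) h1
  calc K = K / φ 1 * φ 1 := by field_simp
    _ ≤ K / φ 1 * φ ((n + m : ℕ) : ℝ) := by gcongr

/-- By the triangle inequality, a change of representatives alters the normalized distance by a
quantity tending to zero. -/
theorem isTropicalDist_tropicalClass (ι : G) {φ : ℝ → ℝ} {A B : ℕ → ProbDiagram.{u} G} {d : ℝ}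
    (h : IsAsympDist A B d) : IsTropicalDist (tropicalClass φ A) (tropicalClass φ B) d := by
  rintro A' ⟨-, hA⟩ B' ⟨-, hB⟩
  rw [isAsympDist_iff ι] at h hA hB ⊢
  have hsum := hA.add hB
  rw [add_zero] at hsum
  refine h.congr_dist (squeeze_zero (fun _ => dist_nonneg) (fun n => ?_) hsum)
  rw [Real.dist_eq, ← mul_sub, abs_mul, abs_of_nonneg (by positivity), ← mul_add]
  refine mul_le_mul_of_nonneg_left ?_ (by positivity)
  have h1 := dist_triangle4 ((A n).toClass ι) ((A' n).toClass ι) ((B' n).toClass ι)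
    ((B n).toClass ι)
  have h2 := dist_triangle4 ((A' n).toClass ι) ((A n).toClass ι) ((B n).toClass ι)
    ((B' n).toClass ι)
  rw [dist_comm ((B' n).toClass ι) ((B n).toClass ι)] at h1
  rw [dist_comm ((A' n).toClass ι) ((A n).toClass ι)] at h2
  rw [abs_le]
  constructor <;> linarith

theorem exists_isAsympDist_condSeq (X Y : ProbDiagram.{u} G) (ι : G) :
    ∃ d, IsAsympDist (condSeq X ι) (condSeq Y ι) d ∧
      d ≤ (2 * (Fintype.card G : ℝ) + 1) * ProbDiagram.intrinsicDist X Y := by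
  simp only [isAsympDist_iff ι, toClass_condSeq_eq_condSum]
  obtain ⟨d, hd⟩ := EntropyClass.exists_tendsto_dist
    (PartitionedSpace.dist_condSum_add_le (X.toPartitioned ι) (ProbDiagram.initialAtomMap X ι))
    (PartitionedSpace.dist_condSum_add_le (Y.toPartitioned ι) (ProbDiagram.initialAtomMap Y ι))
  refine ⟨d, hd, ?_⟩
  have hpos : 0 < 2 * (Fintype.card G : ℝ) + 1 := by positivity
  rw [ProbDiagram.intrinsicDist_eq_edist ι, ← div_le_iff₀' hpos]
  -- The limit does not depend on the coupling or on `ε`, so it suffices to bound it for each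
  -- coupling, up to an arbitrary `ε`.
  refine le_ciInf fun c => ?_
  rw [div_le_iff₀' hpos]
  refine le_of_forall_pos_le_add fun ε hε => ?_
  obtain ⟨K, hK⟩ := c.exists_dist_condSum_le _ _ (ProbDiagram.ker_initialAtomMap X ι)
    (ProbDiagram.ker_initialAtomMap Y ι) hε
  exact EntropyClass.le_of_tendsto_of_le hd hK

end Tropical

theorem propositionp {G : Type v} [SemilatticeInf G] [Fintype G]
    (φ : ℝ → ℝ) (hφ : Tropical.IsAdmissible φ) (hφpos : ∀ t : ℝ, 1 ≤ t → 0 < φ t)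
    (X Y : ProbDiagram.{u} G) (ι : G) :
    Tropical.IsTropicalDiagram φ (Tropical.tropicalCond φ X ι) ∧
      Tropical.IsTropicalDiagram φ (Tropical.tropicalCond φ Y ι) ∧
      ∃ d : ℝ, Tropical.IsTropicalDist (Tropical.tropicalCond φ X ι)
          (Tropical.tropicalCond φ Y ι) d ∧
        d ≤ (2 * (Fintype.card G : ℝ) + 1) * ProbDiagram.intrinsicDist X Y := by
  obtain ⟨d, hd, hle⟩ := Tropical.exists_isAsympDist_condSeq X Y ι
  exact ⟨⟨_, Tropical.isQuasiLinear_condSeq hφ.1 (hφpos 1 le_rfl) X ι, rfl⟩,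
    ⟨_, Tropical.isQuasiLinear_condSeq hφ.1 (hφpos 1 le_rfl) Y ι, rfl⟩,
    d, Tropical.isTropicalDist_tropicalClass ι hd, hle⟩
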